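/- Let $(\mathbb V,d_{\mathbb V})$ be a complete separable metric linear space over $\mathbb C$ with translation invariant metric, and let $k\ge -1$ be an integer. Let $\Lambda_k$ be the space of complex measures $\lambda=\sum_i c_i\delta_{t_i}$ with finite support in $\mathbb R^d$ that annihilate all polynomials of degree at most $k$ (all such measures if $k=-1$), and for $s\in\mathbb R^d$, $r>0$ let $s+r\cdot\lambda=\sum_i c_i\delta_{s+rt_i}$. Let $m_1,\dots,m_M$ be the monomials of degree at most $k$, $b(t)=(m_1(t),\dots,m_M(t))^\top$, fix points $t_1,\dots,t_M\in\mathbb R^d$ for which the matrix $(b(t_1),\dots,b(t_M))$ is invertible, and put $\lambda_t=\delta_t-(\delta_{t_1},\dots,\delta_{t_M})(b(t_1),\dots,b(t_M))^{-1}b(t)\in\Lambda_k$. Let $S_c(\Lambda_k,\mathbb V)$ be the space of linear maps $f:\Lambda_k\to\mathbb V$ for which $t\mapsto f(\lambda_t)$ is continuous, with the topology of locally uniform convergence of $t\mapsto f(\lambda_t)$ and its Borel $\sigma$-field. A scaling action on $\mathbb V$ is a family of maps $T_a:\mathbb V\to\mathbb V$, $a>0$, with $T_a\circ T_b=T_{ab}$,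 $T_1=\mathrm I$, $T_a(0)=0$; $T_{a_n}(x_n)\to T_a(x)$ whenever $a_n\to a>0$ and $x_n\to x$; $d_{\mathbb V}(T_a(x),0)<d_{\mathbb V}(T_b(x),0)$ for $x\ne0$ and $a<b$; and $d_{\mathbb V}(T_a(x),0)\to0$ as $a\downarrow0$. Let $X$ be a random element of $S_c(\Lambda_k,\mathbb V)$ and $B\subset\mathbb R^d$ a Borel set. For every $s\in B$ let $T_s=\{T_{s,a},a>0\}$ be a scaling action, let $c(s,r)>0$ for $r>0$, and let $Y_s$ be a $k$-th order tangent field to $X$ at $s$: a random element of $S_c(\Lambda_k,\mathbb V)$, not almost surely zero, such that the processes $\{T_{s,c(s,r)}(X(s+r\cdot\lambda)),\lambda\in\Lambda_k\}$ are random elements of $S_c(\Lambda_k,\mathbb V)$ and converge in distribution in $S_c(\Lambda_k,\mathbb V)$ to $\{Y_s(\lambda),\lambda\in\Lambda_k\}$ as $r\downarrow0$. Suppose that $s\mapsto c(s,r)$ is Borel measurable on $B$ for every $r>0$. For a set $D\subset B$ say that the regularity condition holds on $D$ if for every $s\in D$ and every convergent sequence $w_n\to w$ in $\mathbb R^d$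 with $s_n:=s+n^{-1}w_n\in D$ for all $n\ge1$, $$T_{s_n,c(s_n,1/n)}\circ T_{s,c(s,1/n)}^{-1}\longrightarrow \mathrm I ,$$ where $A_n\to\mathrm I$ means that $A_n(x_n)\to x$ whenever $x_n\to x$ in $\mathbb V$. (1) If the regularity condition holds on $B$, then for Lebesgue-almost every $s\in B$ the field $Y_s$ is strictly intrinsically stationary: for every $w\in\mathbb R^d$, $\{Y_s(w+\lambda),\lambda\in\Lambda_k\}$ and $\{Y_s(\lambda),\lambda\in\Lambda_k\}$ have the same finite-dimensional distributions. (2) If the scaling action does not depend on the location, that is $T_{s,a}=T_{s',a}$ for all $s,s'\in B$ and $a>0$, then, without assuming the regularity condition, (a) there are compact sets $K_1,K_2,\ldots\subset B$ such that $B\setminus\bigcup_mK_m$ is a Lebesgue null set and the regularity condition holds on every $K_m$, and (b) for Lebesgue-almost every $s\in B$ the field $Y_s$ is strictly intrinsically stationary. -/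

import Mathlib

open MeasureTheory ProbabilityTheory Filter Topology

namespace TangentField

/-- The Euclidean space `ℝ^d`. -/
abbrev E (d : ℕ) : Type := EuclideanSpace ℝ (Fin d)

/-- `Λ`: complex measures on `ℝ^d` supported on finitely many points; the measure
`∑ᵢ cᵢ δ_{tᵢ}` is the finitely supported function `tᵢ ↦ cᵢ`. -/
abbrev FinMeas (d : ℕ) : Type := E d →₀ ℂ

/-- `∫ g dλ = ∑ᵢ cᵢ g(tᵢ)`. -/
noncomputable def integ {d : ℕ} {V : Type*} [AddCommGroup V] [Module ℂ V]
    (g : E d → V) (l : FinMeas d) : V :=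
  l.sum fun t c => c • g t

/-- The value at `t ∈ ℝ^d` of a complex polynomial in `d` variables. -/
noncomputable def polyVal {d : ℕ} (p : MvPolynomial (Fin d) ℂ) (t : E d) : ℂ :=
  MvPolynomial.eval (fun i => ((t i : ℝ) : ℂ)) p

/-- `Λ_k`: the measures in `Λ` annihilating all polynomials of degree at most `k`.
For `k = -1` the condition is void and `Λ_{-1} = Λ`. -/
noncomputable def Lam (d : ℕ) (k : ℤ) : Submodule ℂ (FinMeas d) where
  carrier := {l | ∀ p : MvPolynomial (Fin d) ℂ, (p.totalDegree : ℤ) ≤ k → integ (polyVal p) l = 0}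
  zero_mem' := by intro p _; simp [integ]
  add_mem' := by
    intro a b ha hb p hp
    have h : integ (polyVal p) (a + b) = integ (polyVal p) a + integ (polyVal p) b :=
      Finsupp.sum_add_index' (by simp) (by intros; simp [add_mul])
    rw [h, ha p hp, hb p hp, add_zero]
  smul_mem' := by
    intro c a ha p hp
    have h : integ (polyVal p) (c • a) = c • integ (polyVal p) a := by
      unfold integ
      rw [Finsupp.sum_smul_index (by simp), Finsupp.smul_sum]
      simp [mul_assoc]
    rw [h, ha p hp, smul_zero]

/-- The measure `s + r·λ`, i.e. the image of `λ` under `u ↦ s + r u`. -/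
noncomputable def moveMeas {d : ℕ} (s : E d) (r : ℝ) (l : FinMeas d) : FinMeas d :=
  Finsupp.mapDomain (fun u => s + r • u) l

theorem moveMeas_mem {d : ℕ} {k : ℤ} (s : E d) (r : ℝ) {l : FinMeas d} (hl : l ∈ Lam d k) :
    moveMeas s r l ∈ Lam d k := by
  intro p hp
  let q : MvPolynomial (Fin d) ℂ :=
    ∑ m ∈ p.support, MvPolynomial.C (p.coeff m) *
      ∏ i, (MvPolynomial.C ((s i : ℝ) : ℂ) + MvPolynomial.C (r : ℂ) * MvPolynomial.X i) ^ m i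
  have hq : q.totalDegree ≤ p.totalDegree := by
    refine MvPolynomial.totalDegree_finsetSum_le fun m hm => ?_
    refine (MvPolynomial.totalDegree_mul _ _).trans ?_
    rw [MvPolynomial.totalDegree_C, zero_add]
    refine (MvPolynomial.totalDegree_finsetProd _ _).trans ?_
    refine le_trans ?_ (MvPolynomial.le_totalDegree hm)
    rw [Finsupp.sum_fintype _ _ (by simp)]
    refine Finset.sum_le_sum fun i _ => ?_
    refine (MvPolynomial.totalDegree_pow _ _).trans ?_
    have h1 : (MvPolynomial.C ((s i : ℝ) : ℂ) + MvPolynomial.C (r : ℂ) * MvPolynomial.X i :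
        MvPolynomial (Fin d) ℂ).totalDegree ≤ 1 := by
      refine (MvPolynomial.totalDegree_add _ _).trans (max_le (by simp) ?_)
      refine (MvPolynomial.totalDegree_mul _ _).trans ?_
      simp
    calc m i * _ ≤ m i * 1 := Nat.mul_le_mul_left _ h1
      _ = m i := mul_one _
  have hv : ∀ u : E d, polyVal p (s + r • u) = polyVal q u := by
    intro u
    simp only [polyVal, q]
    rw [MvPolynomial.eval_eq']
    simp
  have := hl q (by omega)
  unfold integ moveMeas at *
  rw [Finsupp.sum_mapDomain_index (by simp) (by intros; simp [add_mul])]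
  simpa only [hv] using this

/-- `s + r·λ` as an operation on `Λ_k`. -/
noncomputable def move {d : ℕ} {k : ℤ} (s : E d) (r : ℝ) (l : Lam d k) : Lam d k :=
  ⟨moveMeas s r l, moveMeas_mem s r l.2⟩

/-- The translate `w + λ`. -/
noncomputable def translate {d : ℕ} {k : ℤ} (w : E d) (l : Lam d k) : Lam d k :=
  move w 1 l

/-- Exponents of the monomials of degree at most `k` in `d` variables. -/
abbrev MonIdx (d : ℕ) (k : ℤ) : Type := {a : Fin d →₀ ℕ // (a.degree : ℤ) ≤ k}

noncomputable instance (d : ℕ) (k : ℤ) : Fintype (MonIdx d k) :=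
  have : Finite (MonIdx d k) :=
    ((Finsupp.finite_of_degree_le (σ := Fin d) k.toNat).subset
      (fun a (ha : (a.degree : ℤ) ≤ k) => by
        show a.degree ≤ k.toNat
        omega)).to_subtype
  Fintype.ofFinite _

/-- The vector `b(t)` of all monomials of degree at most `k` at `t`. -/
noncomputable def monVec {d : ℕ} {k : ℤ} (t : E d) (a : MonIdx d k) : ℂ :=
  ∏ i, ((t i : ℝ) : ℂ) ^ a.1 i

/-- The matrix `B = (b(t_1), …, b(t_M))` attached to points `t_1, …, t_M`, as many as there are
monomials of degree at most `k`. -/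
noncomputable def nodeMat {d : ℕ} {k : ℤ} (pt : MonIdx d k → E d) :
    Matrix (MonIdx d k) (MonIdx d k) ℂ :=
  Matrix.of fun a j => monVec (pt j) a

/-- A choice of nodes `t_1, …, t_M` for which `B = (b(t_1), …, b(t_M))` has full rank. -/
structure Nodes (d : ℕ) (k : ℤ) where
  pt : MonIdx d k → E d
  fullRank : IsUnit (nodeMat pt).det

/-- The measure `λ_t = δ_t - (δ_{t_1}, …, δ_{t_M}) B⁻¹ b(t)`. -/
noncomputable def Nodes.lamMeas {d : ℕ} {k : ℤ} (τ : Nodes d k) (t : E d) : FinMeas d :=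
  Finsupp.single t 1 - ∑ j, Finsupp.single (τ.pt j) (((nodeMat τ.pt)⁻¹.mulVec (monVec t)) j)

theorem Nodes.lamMeas_mem {d : ℕ} {k : ℤ} (τ : Nodes d k) (t : E d) :
    τ.lamMeas t ∈ Lam d k := by
  intro p hp
  have hI : integ (polyVal p) (τ.lamMeas t) =
      polyVal p t - ∑ j, ((nodeMat τ.pt)⁻¹.mulVec (monVec t)) j * polyVal p (τ.pt j) := by
    have : ∀ l : FinMeas d, integ (polyVal p) l = Finsupp.linearCombination ℂ (polyVal p) l :=
      fun _ => rfl
    rw [this, Nodes.lamMeas, map_sub, map_sum]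
    simp [Finsupp.linearCombination_single]
  have hP : ∀ u : E d, polyVal p u = ∑ a : MonIdx d k, p.coeff a.1 * monVec u a := by
    intro u
    rw [polyVal, MvPolynomial.eval_eq']
    symm
    have hinj : Set.InjOn (fun a : MonIdx d k => a.1) (Finset.univ : Finset (MonIdx d k)) :=
      Subtype.val_injective.injOn
    rw [show (∑ a : MonIdx d k, p.coeff a.1 * monVec u a) =
      ∑ m ∈ Finset.univ.image (fun a : MonIdx d k => a.1),
        p.coeff m * ∏ i, ((u i : ℝ) : ℂ) ^ m i from
      (Finset.sum_image (f := fun m : Fin d →₀ ℕ =>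
        p.coeff m * ∏ i, ((u i : ℝ) : ℂ) ^ m i) hinj).symm]
    symm
    refine Finset.sum_subset ?_ ?_
    · intro m hm
      have h1 := MvPolynomial.le_totalDegree hm
      have h2 : m.degree ≤ p.totalDegree := h1
      exact Finset.mem_image.2 ⟨⟨m, by omega⟩, Finset.mem_univ _, rfl⟩
    · intro m _ hm
      rw [MvPolynomial.notMem_support_iff.1 hm, zero_mul]
  have hB : ∀ a : MonIdx d k, ∑ j, ((nodeMat τ.pt)⁻¹.mulVec (monVec t)) j * monVec (τ.pt j) a = monVec t a := by
    intro a
    have h1 : (nodeMat τ.pt).mulVec ((nodeMat τ.pt)⁻¹.mulVec (monVec t)) = monVec t := by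
      rw [Matrix.mulVec_mulVec, Matrix.mul_nonsing_inv _ τ.fullRank, Matrix.one_mulVec]
    have h2 := congrFun h1 a
    rw [← h2]
    simp only [Matrix.mulVec, dotProduct, nodeMat, Matrix.of_apply]
    exact Finset.sum_congr rfl fun j _ => mul_comm _ _
  have hS : ∑ j, ((nodeMat τ.pt)⁻¹.mulVec (monVec t)) j * polyVal p (τ.pt j) = polyVal p t := by
    calc ∑ j, ((nodeMat τ.pt)⁻¹.mulVec (monVec t)) j * polyVal p (τ.pt j)
        = ∑ j, ∑ a : MonIdx d k,
            p.coeff a.1 * (((nodeMat τ.pt)⁻¹.mulVec (monVec t)) j * monVec (τ.pt j) a) := by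
          refine Finset.sum_congr rfl fun j _ => ?_
          rw [hP (τ.pt j), Finset.mul_sum]
          exact Finset.sum_congr rfl fun a _ => by ring
      _ = ∑ a : MonIdx d k, p.coeff a.1 * monVec t a := by
          rw [Finset.sum_comm]
          refine Finset.sum_congr rfl fun a _ => ?_
          rw [← Finset.mul_sum, hB a]
      _ = polyVal p t := (hP t).symm
  rw [hI, hS, sub_self]

/-- `λ_t` as an element of `Λ_k`. -/
noncomputable def Nodes.lam {d : ℕ} {k : ℤ} (τ : Nodes d k) (t : E d) : Lam d k :=
  ⟨τ.lamMeas t, τ.lamMeas_mem t⟩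

section PathSpace

variable {d : ℕ} {k : ℤ} (τ : Nodes d k) (V : Type*) [AddCommGroup V] [Module ℂ V]
  [MetricSpace V]

/-- `S_c(Λ_k, V)`: the linear maps `f : Λ_k → V` whose representation `t ↦ f(λ_t)` is
continuous. The nodes only enter through the choice of this representation. -/
structure Sc where
  toLin : Lam d k →ₗ[ℂ] V
  cont : Continuous fun t => toLin (τ.lam t)

noncomputable instance : CoeFun (Sc τ V) fun _ => Lam d k → V := ⟨fun f => f.toLin⟩

variable {τ V}

/-- The representation `t ↦ f(λ_t)` of `f`. -/
noncomputable def Sc.rep (f : Sc τ V) : C(E d, V) := ⟨fun t => f (τ.lam t), f.cont⟩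

/-- The topology of locally uniform convergence of the representations. -/
noncomputable instance : TopologicalSpace (Sc τ V) := TopologicalSpace.induced Sc.rep inferInstance

noncomputable instance : MeasurableSpace (Sc τ V) := borel _

instance : BorelSpace (Sc τ V) := ⟨rfl⟩

end PathSpace

/-- Scaling actions `{T_a, a > 0}` on `V`; the values `T a` for `a ≤ 0` play no role. -/
structure IsScalingAction {V : Type*} [AddCommGroup V] [MetricSpace V] (T : ℝ → V → V) :
    Prop where
  comp : ∀ a b, 0 < a → 0 < b → ∀ x, T a (T b x) = T (a * b) x
  one : ∀ x, T 1 x = x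
  zero : ∀ a, 0 < a → T a 0 = 0
  continuous : ∀ (a : ℕ → ℝ) (a₀ : ℝ) (x : ℕ → V) (x₀ : V), (∀ n, 0 < a n) → 0 < a₀ →
    Tendsto a atTop (𝓝 a₀) → Tendsto x atTop (𝓝 x₀) →
    Tendsto (fun n => T (a n) (x n)) atTop (𝓝 (T a₀ x₀))
  radial : ∀ x, x ≠ 0 → ∀ a b, 0 < a → a < b → dist (T a x) 0 < dist (T b x) 0
  small : ∀ x, Tendsto (fun a => dist (T a x) 0) (𝓝[>] 0) (𝓝 0)

/-- `Y` is a `k`-th order tangent field to `X` at `s` with respect to the scaling action `T` and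
the normalization `c(r)`: it is a random element of `S_c(Λ_k, V)`, not almost surely zero, and
the random elements `{T_{c(r)}(X(s + r·λ)), λ ∈ Λ_k}` of `S_c(Λ_k, V)` converge to it in
distribution as `r ↓ 0`. (`Z r` is that random element for `r > 0`.) -/
structure IsTangentField {d : ℕ} {k : ℤ} {τ : Nodes d k} {V : Type*} [AddCommGroup V]
    [Module ℂ V] [MetricSpace V]
    {Ω : Type*} [MeasurableSpace Ω] (P : Measure Ω) [IsProbabilityMeasure P] (X : Ω → Sc τ V)
    (s : E d) (T : ℝ → V → V) (c : ℝ → ℝ)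
    {Ω' : Type*} [MeasurableSpace Ω'] (P' : Measure Ω') [IsProbabilityMeasure P']
    (Y : Ω' → Sc τ V) : Prop where
  measurable : Measurable Y
  nonzero : ¬ ∀ᵐ ω ∂P', ∀ l, Y ω l = 0
  pos : ∀ r, 0 < r → 0 < c r
  tendsto : ∃ Z : ℝ → Ω → Sc τ V,
    (∀ r, 0 < r → ∀ ω l, Z r ω l = T (c r) (X ω (move s r l))) ∧
    TendstoInDistribution Z (𝓝[>] 0) Y (fun _ => P) P'

/-- `A_n → I` for operators on `V`: `A_n(x_n) → x` whenever `x_n → x`. -/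
def TendstoToId {V : Type*} [TopologicalSpace V] (A : ℕ → V → V) : Prop :=
  ∀ (x : ℕ → V) (x₀ : V), Tendsto x atTop (𝓝 x₀) → Tendsto (fun n => A n (x n)) atTop (𝓝 x₀)

/-- The regularity condition on `B`: for `s ∈ B` and `w_n → w` with `s_n = s + w_n / n ∈ B` for
`n ≥ 1`, one has `T_{s_n, c(s_n, 1/n)} ∘ T_{s, c(s, 1/n)}⁻¹ → I`. For a scaling action the
inverse of `T_{s,a}` is `T_{s,1/a}`. -/
def ScalingRegularOn {d : ℕ} {V : Type*} [TopologicalSpace V] (B : Set (E d))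
    (T : E d → ℝ → V → V) (c : E d → ℝ → ℝ) : Prop :=
  ∀ s ∈ B, ∀ (w : ℕ → E d) (w₀ : E d), Tendsto w atTop (𝓝 w₀) →
    ∀ σ : ℕ → E d, (∀ n, 1 ≤ n → σ n = s + (n : ℝ)⁻¹ • w n) → (∀ n, 1 ≤ n → σ n ∈ B) →
      TendstoToId fun n x =>
        T (σ n) (c (σ n) (n : ℝ)⁻¹) (T s (c s (n : ℝ)⁻¹)⁻¹ x)

/-- Strict intrinsic stationarity: `{Y(w + λ)}` and `{Y(λ)}` have the same finite-dimensional
distributions for every `w`. -/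
def IsStrictlyIntrinsicallyStationary {d : ℕ} {k : ℤ} {τ : Nodes d k} {V : Type*}
    [AddCommGroup V] [Module ℂ V] [MetricSpace V] [MeasurableSpace V]
    {Ω : Type*} [MeasurableSpace Ω] (P : Measure Ω) (Y : Ω → Sc τ V) : Prop :=
  ∀ (w : E d) (m : ℕ) (l : Fin m → Lam d k),
    IdentDistrib (fun ω i => Y ω (translate w (l i))) (fun ω i => Y ω (l i)) P P

end TangentField

open TangentField

/-!
The fields in `S_c(Λ_k, V)` are handled through their paths in the second countable metrizable
space `C(ℝ^d, V)`: a field is recovered from its path by integration (`Sc.apply_eq_integ`). The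
rescaled field at `s` with step `1/n` is a random path, and it converges in law to the path of
`Y_s`.

On a second countable space countably many bounded continuous functions `h_i` decide weak
convergence (`exists_isConvergenceDetermining`). For `s ∈ B` the expectation `F i n s` of `h_i` at
the rescaled path converges as `n → ∞`, so, given `i` and a tolerance, `s` lies in one of
countably many sets (`nearConstSet`) on which `F i n` is nearly a constant from some index on.

*Stationarity.* Almost every `s ∈ B` is a density point of all of these sets that contain it
(`ae_exists_tendsto_of_mem`; the sets need not be measurable). For such `s` and given `w` there
are points `s_n = s + w_n/n` in the set with `w_n → w`. The rescaled path at `s_n` is the rescaled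
path at `s`, translated by `w_n`, under the map `T_{s_n,c(s_n,1/n)} ∘ T_{s,c(s,1/n)}⁻¹`. By
regularity and the extended continuous mapping theorem (`tendstoInDistribution_extended_comp`) it
converges in law to `Y_s(w + ·)`; by the choice of the set its `h_i`-expectation stays close to
that of `Y_s`. So `Y_s(w + ·)` and `Y_s` have the same law.

*Regularity for a single scaling action.* Now the sets above are measurable, and `B` is exhausted
by compact sets on which they are all relatively open (`exists_isCompact_seq_forall_inter_open`).
For `s` and `s_n = s + w_n/n` in such a compact set the rescaled paths at `s_n` converge in law to
`Y_s`. Regularity means that `a_n = c(s_n,1/n) / c(s,1/n)` tends to `1`. Since `Y_s ≠ 0`, the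
ratios have limit points `a ∈ (0, ∞)` (`exists_subseq_isLawInvariant`), for which `T_a Y_s(w + ·)`
and `Y_s` have the same law; comparing the steps `1/n` and `2/n` likewise gives `b > 0` for which
`T_b Y_s(2·)` has this law. The dilation by `2` turns the translation by `w` into that by `2w`,
which therefore goes with both scales `a` and `a²`, so `a = 1` (`IsLawInvariant.eq_one`). The
almost sure stationarity follows from the first part on each of the compact sets.
-/

namespace TangentField

open scoped NNReal ENNReal BoundedContinuousFunction

/-! ### Convergence in law -/

/-- A sequence of bounded continuous functions `S → [0, ∞)` is convergence determining if a
sequence of probability measures converges weakly as soon as the integrals of each of these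
functions converge to the right limit. -/
def IsConvergenceDetermining {S : Type*} [TopologicalSpace S] [MeasurableSpace S]
    [OpensMeasurableSpace S] (h : ℕ → S →ᵇ ℝ≥0) : Prop :=
  ∀ (μs : ℕ → ProbabilityMeasure S) (μ : ProbabilityMeasure S),
    (∀ i, Tendsto (fun n => ∫ x, (h i x : ℝ) ∂(μs n : Measure S)) atTop
      (𝓝 (∫ x, (h i x : ℝ) ∂(μ : Measure S)))) → Tendsto μs atTop (𝓝 μ)

theorem integral_map_boundedContinuous {S : Type*} [TopologicalSpace S] [MeasurableSpace S]
    [OpensMeasurableSpace S] {Ω : Type*} [MeasurableSpace Ω] {P : Measure Ω} (f : S →ᵇ ℝ≥0)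
    {X : Ω → S} (hX : AEMeasurable X P) :
    ∫ x, (f x : ℝ) ∂(P.map X) = ∫ ω, (f (X ω) : ℝ) ∂P :=
  integral_map hX (NNReal.continuous_coe.comp f.continuous).measurable.aestronglyMeasurable

theorem IsConvergenceDetermining.tendstoInDistribution {S : Type*} [TopologicalSpace S]
    [MeasurableSpace S] [OpensMeasurableSpace S] {h : ℕ → S →ᵇ ℝ≥0}
    (hh : IsConvergenceDetermining h) {Ω Ω' : Type*} [MeasurableSpace Ω] [MeasurableSpace Ω']
    {P : Measure Ω} [IsProbabilityMeasure P] {P' : Measure Ω'} [IsProbabilityMeasure P']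
    {X : ℕ → Ω → S} {Z : Ω' → S} (hX : ∀ n, AEMeasurable (X n) P) (hZ : AEMeasurable Z P')
    (hi : ∀ i, Tendsto (fun n => ∫ ω, (h i (X n ω) : ℝ) ∂P) atTop
      (𝓝 (∫ ω, (h i (Z ω) : ℝ) ∂P'))) :
    TendstoInDistribution X atTop Z (fun _ => P) P' := by
  refine ⟨hX, hZ, hh _ _ fun i => ?_⟩
  have h1 := hi i
  rw [← integral_map_boundedContinuous (h i) hZ] at h1
  simp only [← integral_map_boundedContinuous (h i) (hX _)] at h1
  exact h1

theorem IsConvergenceDetermining.identDistrib {S : Type*} [TopologicalSpace S]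
    [HasOuterApproxClosed S] [MeasurableSpace S] [BorelSpace S] {h : ℕ → S →ᵇ ℝ≥0}
    (hh : IsConvergenceDetermining h) {Ω : Type*} [MeasurableSpace Ω]
    {P : Measure Ω} [IsProbabilityMeasure P] {X Z : Ω → S} (hX : AEMeasurable X P)
    (hZ : AEMeasurable Z P) (hi : ∀ i, ∫ ω, (h i (X ω) : ℝ) ∂P = ∫ ω, (h i (Z ω) : ℝ) ∂P) :
    IdentDistrib X Z P P := by
  have h1 := hh.tendstoInDistribution (X := fun _ => X) (fun _ => hX) hZ fun i => by
    rw [hi i]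
    exact tendsto_const_nhds
  exact ⟨hX, hZ, tendstoInDistribution_unique _ (tendstoInDistribution_const hX) h1⟩

/-- On a second countable space, continuous functions decreasing to the indicators of the
complements of finite unions of basic open sets are convergence determining: they control `liminf
μₙ(G)` for such a finite union `G`, and every open set is an increasing union of such `G`. -/
theorem exists_isConvergenceDetermining (S : Type*) [TopologicalSpace S]
    [SecondCountableTopology S] [HasOuterApproxClosed S] [MeasurableSpace S] [BorelSpace S] :
    ∃ h : ℕ → S →ᵇ ℝ≥0, IsConvergenceDetermining h := by
  classical
  let b := TopologicalSpace.countableBasis S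
  have hb := TopologicalSpace.isBasis_countableBasis S
  have : Countable b := (TopologicalSpace.countable_countableBasis S).to_subtype
  let G : Finset b → Set S := fun s => ⋃ v ∈ s, (v : Set S)
  have hG : ∀ s, IsOpen (G s) := fun s => isOpen_biUnion fun v _ => hb.isOpen v.2
  obtain ⟨e, he⟩ := exists_surjective_nat (Finset b × ℕ)
  refine ⟨fun i => (hG (e i).1).isClosed_compl.apprSeq (e i).2, fun μs μ hμ => ?_⟩
  have key : ∀ s, (μ : Measure S) (G s) ≤ atTop.liminf fun n => (μs n : Measure S) (G s) := by
    intro s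
    refine le_measure_liminf_of_limsup_measure_compl_le (hG s).measurableSet ?_
    refine ge_of_tendsto' (HasOuterApproxClosed.tendsto_lintegral_apprSeq
      (hG s).isClosed_compl (μ : Measure S)) fun k => ?_
    obtain ⟨i, hi⟩ := he (s, k)
    have h1 := hμ i
    simp only [hi] at h1
    have h2 : Tendsto (fun n => ∫⁻ x, (hG s).isClosed_compl.apprSeq k x ∂(μs n : Measure S)) atTop
        (𝓝 (∫⁻ x, (hG s).isClosed_compl.apprSeq k x ∂(μ : Measure S))) := by
      have h3 : ∀ ν : ProbabilityMeasure S,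
          ∫⁻ x, (hG s).isClosed_compl.apprSeq k x ∂(ν : Measure S) =
            ENNReal.ofReal (∫ x, ((hG s).isClosed_compl.apprSeq k x : ℝ) ∂(ν : Measure S)) :=
        fun ν => lintegral_coe_eq_integral _
          (BoundedContinuousFunction.integrable_of_nnreal _ _)
      simp only [h3]
      exact ENNReal.tendsto_ofReal h1
    rw [← h2.limsup_eq]
    exact limsup_le_limsup (Eventually.of_forall fun n =>
      HasOuterApproxClosed.measure_le_lintegral _ _ _)
  refine tendsto_of_forall_isOpen_le_liminf' fun U hU => ?_
  let J := {s : Finset b // ∀ v ∈ s, (v : Set S) ⊆ U}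
  have hUJ : U = ⋃ s : J, G s.1 := by
    apply Set.Subset.antisymm
    · intro x hx
      obtain ⟨v, hv, hxv, hvU⟩ := hb.exists_subset_of_mem_open hx hU
      exact Set.mem_iUnion.2 ⟨⟨{⟨v, hv⟩}, by simpa using hvU⟩, by simpa [G] using ⟨hv, hxv⟩⟩
    · exact Set.iUnion_subset fun s => Set.iUnion₂_subset s.2
  have hdir : Directed (· ⊆ ·) fun s : J => G s.1 := by
    intro s t
    refine ⟨⟨s.1 ∪ t.1, fun v hv => ?_⟩, ?_, ?_⟩
    · rcases Finset.mem_union.1 hv with h | h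
      exacts [s.2 v h, t.2 v h]
    · exact Set.biUnion_subset_biUnion_left fun v hv => Finset.mem_union_left _ hv
    · exact Set.biUnion_subset_biUnion_left fun v hv => Finset.mem_union_right _ hv
  conv_lhs => rw [hUJ]
  rw [hdir.measure_iUnion]
  refine iSup_le fun s => (key s.1).trans ?_
  refine liminf_le_liminf (Eventually.of_forall fun n => measure_mono ?_)
  exact Set.iUnion₂_subset s.2

/-- The extended continuous mapping theorem: if `Xₙ → Z` in law and `gₙ(xₙ) → g₀(x)` whenever
`xₙ → x`, then `gₙ(Xₙ) → g₀(Z)` in law. For open `G`, the preimage `g₀⁻¹(G)` is covered by the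
increasing open sets `Uₖ`, the interiors of `⋂_{n ≥ k} gₙ⁻¹(G)`, and the portmanteau theorem applies
to each `Uₖ`. -/
theorem tendstoInDistribution_extended_comp {S F : Type*} [TopologicalSpace S] [MeasurableSpace S]
    [OpensMeasurableSpace S] [HasOuterApproxClosed S] [TopologicalSpace F] [MeasurableSpace F]
    [OpensMeasurableSpace F] {Ω Ω' : Type*} [MeasurableSpace Ω]
    [MeasurableSpace Ω'] {P : Measure Ω} [IsProbabilityMeasure P] {P' : Measure Ω'}
    [IsProbabilityMeasure P'] {X : ℕ → Ω → S} {Z : Ω' → S}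
    (h : TendstoInDistribution X atTop Z (fun _ => P) P') {g : ℕ → S → F} {g₀ : S → F}
    (hg : ∀ x, Tendsto (fun p : ℕ × S => g p.1 p.2) (atTop ×ˢ 𝓝 x) (𝓝 (g₀ x)))
    (hW : ∀ n, AEMeasurable (fun ω => g n (X n ω)) P) (hZ : AEMeasurable (fun ω => g₀ (Z ω)) P') :
    TendstoInDistribution (fun n ω => g n (X n ω)) atTop (fun ω => g₀ (Z ω)) (fun _ => P) P' := by
  refine ⟨hW, hZ, tendsto_of_forall_isOpen_le_liminf' fun G hG => ?_⟩
  let U : ℕ → Set S := fun k => interior {y | ∀ n ≥ k, g n y ∈ G}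
  have hUm : Monotone U := fun k l hkl => interior_mono fun y hy n hn => hy n (hkl.trans hn)
  have hsub : g₀ ⁻¹' G ⊆ ⋃ k, U k := by
    intro x hx
    have h1 := (hg x).eventually (hG.mem_nhds hx)
    obtain ⟨pa, hpa, pb, hpb, hab⟩ := eventually_prod_iff.1 h1
    obtain ⟨k, hk⟩ := eventually_atTop.1 hpa
    refine Set.mem_iUnion.2 ⟨k, mem_interior_iff_mem_nhds.2 ?_⟩
    filter_upwards [hpb] with y hy n hn
    exact hab (hk n hn) hy
  show P'.map (fun ω => g₀ (Z ω)) G ≤ liminf (fun n => P.map (fun ω => g n (X n ω)) G) atTop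
  calc P'.map (fun ω => g₀ (Z ω)) G = P' (Z ⁻¹' (g₀ ⁻¹' G)) :=
        Measure.map_apply_of_aemeasurable hZ hG.measurableSet
    _ ≤ P' (Z ⁻¹' ⋃ k, U k) := measure_mono (Set.preimage_mono hsub)
    _ = P'.map Z (⋃ k, U k) := (Measure.map_apply_of_aemeasurable h.aemeasurable_limit
        (isOpen_iUnion fun k => isOpen_interior).measurableSet).symm
    _ = ⨆ k, P'.map Z (U k) := hUm.measure_iUnion
    _ ≤ _ := iSup_le fun k => ?_
  have h2 := ProbabilityMeasure.le_liminf_measure_open_of_tendsto h.tendsto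
    (isOpen_interior : IsOpen (U k))
  refine h2.trans (liminf_le_liminf ?_)
  filter_upwards [eventually_ge_atTop k] with n hn
  show P.map (X n) (U k) ≤ P.map (fun ω => g n (X n ω)) G
  rw [Measure.map_apply_of_aemeasurable (h.forall_aemeasurable n) isOpen_interior.measurableSet,
    Measure.map_apply_of_aemeasurable (hW n) hG.measurableSet]
  exact measure_mono fun ω hω => interior_subset hω n hn

theorem tendstoInDistribution_comp_subseq {S : Type*} [TopologicalSpace S] [MeasurableSpace S]
    [OpensMeasurableSpace S] {Ω Ω' : Type*} [MeasurableSpace Ω]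
    [MeasurableSpace Ω'] {P : Measure Ω} [IsProbabilityMeasure P] {P' : Measure Ω'}
    [IsProbabilityMeasure P'] {ι : Type*} {L : Filter ι} {X : ι → Ω → S} {Z : Ω' → S}
    (h : TendstoInDistribution X L Z (fun _ => P) P') {u : ℕ → ι} (hu : Tendsto u atTop L) :
    TendstoInDistribution (fun n => X (u n)) atTop Z (fun _ => P) P' :=
  ⟨fun n => h.forall_aemeasurable (u n), h.aemeasurable_limit, h.tendsto.comp hu⟩

theorem tendsto_integral_of_tendstoInDistribution {S : Type*} [TopologicalSpace S]
    [MeasurableSpace S] [OpensMeasurableSpace S] {Ω Ω' : Type*} [MeasurableSpace Ω]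
    [MeasurableSpace Ω'] {P : Measure Ω} [IsProbabilityMeasure P] {P' : Measure Ω'}
    [IsProbabilityMeasure P'] {X : ℕ → Ω → S} {Z : Ω' → S}
    (h : TendstoInDistribution X atTop Z (fun _ => P) P') (f : S →ᵇ ℝ≥0) :
    Tendsto (fun n => ∫ ω, (f (X n ω) : ℝ) ∂P) atTop (𝓝 (∫ ω, (f (Z ω) : ℝ) ∂P')) := by
  let f' : S →ᵇ ℝ := BoundedContinuousFunction.comp _
    (show LipschitzWith 1 ((↑) : ℝ≥0 → ℝ) from isometry_subtype_coe.lipschitz) f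
  have h1 := ProbabilityMeasure.tendsto_iff_forall_integral_tendsto.1 h.tendsto f'
  rw [← integral_map_boundedContinuous f h.aemeasurable_limit]
  simp only [← integral_map_boundedContinuous f (h.forall_aemeasurable _)]
  exact h1

/-- Uniqueness of limits in law, when one of the limits is the constant `0`. -/
theorem ae_eq_zero_of_tendstoInDistribution {S : Type*} [Zero S] [TopologicalSpace S] [T1Space S]
    [HasOuterApproxClosed S] [MeasurableSpace S] [BorelSpace S] {Ω Ω' : Type*} [MeasurableSpace Ω]
    [MeasurableSpace Ω'] {P : Measure Ω} [IsProbabilityMeasure P] {P' : Measure Ω'}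
    [IsProbabilityMeasure P'] {U : ℕ → Ω → S} {ξ : Ω' → S}
    (h : TendstoInDistribution U atTop ξ (fun _ => P) P')
    (h0 : TendstoInDistribution U atTop (fun _ : Ω' => (0 : S)) (fun _ => P) P') :
    ∀ᵐ ω ∂P', ξ ω = 0 := by
  have h1 : IdentDistrib ξ (fun _ => (0 : S)) P' P' :=
    ⟨h.aemeasurable_limit, aemeasurable_const, tendstoInDistribution_unique U h h0⟩
  exact h1.symm.ae_snd (p := fun x => x = 0) (measurableSet_singleton 0)
    (Eventually.of_forall fun _ => rfl)

/-! ### Exhaustion by compact sets, and density points -/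

/-- Countably many measurable sets become relatively open on compact sets that exhaust `B` up to a
null set. Applied to the sets `nearConstSet F B p`, it does the work of the theorems of Egorov
and Lusin at once. -/
theorem exists_isCompact_seq_forall_inter_open {α : Type*} [TopologicalSpace α] [T2Space α]
    [MeasurableSpace α] [BorelSpace α] (μ : Measure α) [IsFiniteMeasure μ] [μ.OuterRegular]
    [μ.InnerRegularCompactLTTop] {B : Set α} (hB : MeasurableSet B) {ι : Type*} [Countable ι]
    (S : ι → Set α) (hS : ∀ i, MeasurableSet (S i)) :
    ∃ K : ℕ → Set α, (∀ m, IsCompact (K m) ∧ K m ⊆ B ∧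
      ∀ i, ∃ O, IsOpen O ∧ K m ∩ S i = K m ∩ O) ∧ μ (B \ ⋃ m, K m) = 0 := by
  have key : ∀ ε : ℝ≥0∞, ε ≠ 0 → ∃ K, (IsCompact K ∧ K ⊆ B ∧
      ∀ i, ∃ O, IsOpen O ∧ K ∩ S i = K ∩ O) ∧ μ (B \ K) ≤ ε + ε := by
    intro ε hε
    obtain ⟨δ, hδ, hδε⟩ := ENNReal.exists_pos_sum_of_countable' hε ι
    choose O hSO hO _ hOδ using fun i =>
      (hS i).exists_isOpen_sdiff_lt (measure_ne_top μ _) (hδ i).ne'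
    have hC : MeasurableSet (B \ ⋃ i, O i \ S i) :=
      hB.diff (MeasurableSet.iUnion fun i => (hO i).measurableSet.diff (hS i))
    obtain ⟨K, hKC, hK, hKε⟩ := hC.exists_isCompact_sdiff_lt (measure_ne_top μ _) hε
    refine ⟨K, ⟨hK, hKC.trans Set.sdiff_subset, fun i => ⟨O i, hO i, ?_⟩⟩, ?_⟩
    · ext x
      refine and_congr_right fun hx => ⟨fun h => hSO i h, fun h => ?_⟩
      by_contra h'
      exact (hKC hx).2 (Set.mem_iUnion.2 ⟨i, h, h'⟩)
    · calc μ (B \ K) ≤ μ ((⋃ i, O i \ S i) ∪ ((B \ ⋃ i, O i \ S i) \ K)) := by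
            refine measure_mono fun x hx => ?_
            by_cases h : x ∈ ⋃ i, O i \ S i
            · exact Or.inl h
            · exact Or.inr ⟨⟨hx.1, h⟩, hx.2⟩
        _ ≤ μ (⋃ i, O i \ S i) + μ ((B \ ⋃ i, O i \ S i) \ K) := measure_union_le _ _
        _ ≤ ε + ε := by
            refine add_le_add ?_ hKε.le
            exact (measure_iUnion_le _).trans
              ((ENNReal.tsum_le_tsum fun i => (hOδ i).le).trans hδε.le)
  choose K hK hKε using fun m : ℕ => key (((m : ℝ≥0∞) + 1)⁻¹) (by simp)
  refine ⟨K, hK, le_antisymm ?_ zero_le⟩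
  have hlim : Tendsto (fun m : ℕ => ((m : ℝ≥0∞) + 1)⁻¹ + ((m : ℝ≥0∞) + 1)⁻¹) atTop (𝓝 0) := by
    have h1 : Tendsto (fun m : ℕ => ((m : ℝ≥0∞) + 1)⁻¹) atTop (𝓝 0) := by
      have := (tendsto_add_atTop_iff_nat 1).2 ENNReal.tendsto_inv_nat_nhds_zero
      simpa using this
    simpa using h1.add h1
  exact ge_of_tendsto' hlim fun m =>
    (measure_mono (Set.sdiff_subset_sdiff_right (Set.subset_iUnion K m))).trans (hKε m)

/-- Almost every point `s` of a set `A`, which need not be measurable, can be approached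
inside `A` at scale `1/n` from any direction: this is the Lebesgue density theorem for the outer
measure of `A`, applied to balls with radius `ρ/n` around `s + w₀/n`. For `n = 0` the
point `s + 0⁻¹ • w 0` is `s` itself. -/
theorem ae_exists_tendsto_of_mem {d : ℕ} (A : Set (E d)) :
    ∀ᵐ s ∂(volume : Measure (E d)), s ∈ A → ∀ (w₀ : E d), ∃ w : ℕ → E d,
      Tendsto w atTop (𝓝 w₀) ∧ ∀ n : ℕ, s + (n : ℝ)⁻¹ • w n ∈ A := by
  have h : ∀ᵐ s ∂(volume : Measure (E d)), s ∈ A → ∀ K : ℕ,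
      ∀ (w : ℕ → E d) (δ : ℕ → ℝ), Tendsto δ atTop (𝓝[>] 0) →
        (∀ᶠ j in atTop, s ∈ Metric.closedBall (w j) ((K : ℝ) * δ j)) →
          Tendsto (fun j => volume (A ∩ Metric.closedBall (w j) (δ j)) /
            volume (Metric.closedBall (w j) (δ j))) atTop (𝓝 1) := by
    refine ae_imp_of_ae_restrict (ae_all_iff.2 fun K => ?_)
    filter_upwards [IsUnifLocDoublingMeasure.ae_tendsto_measure_inter_div
      (volume : Measure (E d)) A K] with s hs w δ hδ hw
    exact hs w δ hδ hw
  filter_upwards [h] with s hs hsA w₀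
  -- The ball of radius `ρ/n` around `s + w₀/n` has centre within `(‖w₀‖/ρ)` radii of `s`,
  -- so it eventually meets `A`.
  have key : ∀ ρ : ℝ, 0 < ρ → ∀ᶠ n : ℕ in atTop, ∃ v, dist v w₀ ≤ ρ ∧ s + (n : ℝ)⁻¹ • v ∈ A := by
    intro ρ hρ
    obtain ⟨K, hK⟩ := exists_nat_ge (‖w₀‖ / ρ)
    have hδ : Tendsto (fun n : ℕ => ρ * ((n : ℝ) + 1)⁻¹) atTop (𝓝[>] 0) := by
      refine tendsto_nhdsWithin_iff.2 ⟨?_, Eventually.of_forall fun n => ?_⟩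
      · simpa using (tendsto_one_div_add_atTop_nhds_zero_nat (𝕜 := ℝ)).const_mul ρ
      · exact Set.mem_Ioi.2 (by positivity)
    have h1 := hs hsA K (fun n => s + ((n : ℝ) + 1)⁻¹ • w₀) _ hδ (Eventually.of_forall fun n => by
      rw [Metric.mem_closedBall, dist_self_add_right, norm_smul,
        Real.norm_of_nonneg (by positivity)]
      rw [div_le_iff₀ hρ] at hK
      calc ((n : ℝ) + 1)⁻¹ * ‖w₀‖ ≤ ((n : ℝ) + 1)⁻¹ * (K * ρ) := by gcongr
        _ = K * (ρ * ((n : ℝ) + 1)⁻¹) := by ring)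
    have h2 := h1.eventually (lt_mem_nhds (zero_lt_one))
    have h3 : ∀ᶠ n : ℕ in atTop, ∃ v, dist v w₀ ≤ ρ ∧ s + ((n + 1 : ℕ) : ℝ)⁻¹ • v ∈ A := by
      filter_upwards [h2] with n hn
      have h4 : volume
          (A ∩ Metric.closedBall (s + ((n : ℝ) + 1)⁻¹ • w₀) (ρ * ((n : ℝ) + 1)⁻¹)) ≠ 0 := by
        intro h0
        rw [h0, ENNReal.zero_div] at hn
        exact lt_irrefl _ hn
      obtain ⟨x, hxA, hx⟩ := nonempty_of_measure_ne_zero h4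
      have hn0 : (0 : ℝ) < (n : ℝ) + 1 := by positivity
      refine ⟨((n : ℝ) + 1) • (x - s), ?_, ?_⟩
      · rw [Metric.mem_closedBall, dist_eq_norm] at hx
        rw [dist_eq_norm]
        have : ((n : ℝ) + 1) • (x - s) - w₀ = ((n : ℝ) + 1) • (x - (s + ((n : ℝ) + 1)⁻¹ • w₀)) := by
          simp only [smul_sub, smul_add, smul_inv_smul₀ hn0.ne']
          abel
        rw [this, norm_smul, Real.norm_of_nonneg hn0.le]
        calc _ ≤ ((n : ℝ) + 1) * (ρ * ((n : ℝ) + 1)⁻¹) := by gcongr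
          _ = ρ := by field_simp
      · push_cast
        rw [inv_smul_smul₀ hn0.ne']
        simpa using hxA
    exact (eventually_atTop.1 h3).elim fun N hN => eventually_atTop.2 ⟨N + 1, fun n hn => by
      obtain ⟨m, rfl⟩ : ∃ m, n = m + 1 := ⟨n - 1, by omega⟩
      exact hN m (by omega)⟩
  -- Choose `w n` admissible and within `1/(n+1)` of the distance from `w₀` to the admissible
  -- vectors; that distance tends to `0`.
  let D : ℕ → Set ℝ := fun n => (fun v => dist v w₀) '' {v | s + (n : ℝ)⁻¹ • v ∈ A}
  have hne : ∀ n, (D n).Nonempty := fun n => ⟨_, 0, by simpa using hsA, rfl⟩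
  have hbdd : ∀ n, BddBelow (D n) := fun n => ⟨0, by rintro _ ⟨v, -, rfl⟩; exact dist_nonneg⟩
  have hch : ∀ n : ℕ, ∃ v, s + (n : ℝ)⁻¹ • v ∈ A ∧ dist v w₀ < sInf (D n) + ((n : ℝ) + 1)⁻¹ := by
    intro n
    obtain ⟨_, ⟨v, hv, rfl⟩, hlt⟩ := Real.lt_sInf_add_pos (hne n)
      (show (0 : ℝ) < ((n : ℝ) + 1)⁻¹ by positivity)
    exact ⟨v, hv, hlt⟩
  choose w hwA hw using hch
  refine ⟨w, Metric.tendsto_atTop.2 fun ε hε => ?_, hwA⟩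
  have h5 : ∀ᶠ n : ℕ in atTop, ((n : ℝ) + 1)⁻¹ < ε / 2 := by
    have := (tendsto_one_div_add_atTop_nhds_zero_nat (𝕜 := ℝ)).eventually
      (gt_mem_nhds (half_pos hε))
    simpa using this
  obtain ⟨N, hN⟩ := eventually_atTop.1 (h5.and (key (ε / 2) (half_pos hε)))
  refine ⟨N, fun n hn => ?_⟩
  obtain ⟨h6, v, hv, hvA⟩ := hN n hn
  have h7 : sInf (D n) ≤ ε / 2 := (csInf_le (hbdd n) ⟨v, hvA, rfl⟩).trans hv
  linarith [hw n]

/-! ### Fields, paths and scaling actions -/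

section PathSpace

variable {d : ℕ} {k : ℤ} {V : Type*} [AddCommGroup V] [Module ℂ V]

theorem integ_moveMeas (g : E d → V) (s : E d) (r : ℝ) (l : FinMeas d) :
    integ g (moveMeas s r l) = integ (fun u => g (s + r • u)) l :=
  Finsupp.sum_mapDomain_index (by simp) (by intros; simp [add_smul])

theorem moveMeas_moveMeas (s w : E d) (r r' : ℝ) (l : FinMeas d) :
    moveMeas s r (moveMeas w r' l) = moveMeas (s + r • w) (r * r') l := by
  unfold moveMeas
  rw [← Finsupp.mapDomain_comp]
  congr 1
  funext u
  simp [smul_add, mul_smul, add_assoc]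

theorem moveMeas_zero_one (l : FinMeas d) : moveMeas 0 1 l = l := by
  simp only [moveMeas, zero_add, one_smul]
  exact Finsupp.mapDomain_id

theorem move_move (s w : E d) (r r' : ℝ) (l : Lam d k) :
    move s r (move w r' l) = move (s + r • w) (r * r') l :=
  Subtype.ext (moveMeas_moveMeas s w r r' l)

theorem integ_lamMeas (τ : Nodes d k) (g : E d → V) (t : E d) :
    integ g (τ.lamMeas t) =
      g t - ∑ j, ((nodeMat τ.pt)⁻¹.mulVec (monVec t)) j • g (τ.pt j) := by
  have : ∀ l : FinMeas d, integ g l = Finsupp.linearCombination ℂ g l := fun _ => rfl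
  rw [this, Nodes.lamMeas, map_sub, map_sum]
  simp [Finsupp.linearCombination_single]

theorem integ_monVec {l : FinMeas d} (hl : l ∈ Lam d k) (a : MonIdx d k) :
    integ (fun t => monVec t a) l = 0 := by
  have h := hl (MvPolynomial.monomial a.1 1) (by
    have h1 : (MvPolynomial.monomial a.1 (1 : ℂ)).totalDegree ≤ a.1.degree :=
      MvPolynomial.totalDegree_monomial_le a.1 (1 : ℂ)
    have h2 := a.2
    omega)
  have h2 : polyVal (MvPolynomial.monomial a.1 (1 : ℂ)) = fun t : E d => monVec t a := by
    funext t
    simp [polyVal, monVec, MvPolynomial.eval_monomial, Finsupp.prod_fintype]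
  rwa [h2] at h

theorem integ_lamMeas_eq_self (τ : Nodes d k) {l : FinMeas d} (hl : l ∈ Lam d k) :
    integ τ.lamMeas l = l := by
  have hz : ∀ j, integ (fun t => ((nodeMat τ.pt)⁻¹.mulVec (monVec t)) j) l = 0 := by
    intro j
    simp only [Matrix.mulVec, dotProduct]
    calc integ (fun t => ∑ a, (nodeMat τ.pt)⁻¹ j a * monVec t a) l
        = ∑ a, (nodeMat τ.pt)⁻¹ j a * integ (fun t => monVec t a) l := by
          simp only [integ, Finsupp.sum, smul_eq_mul, Finset.mul_sum]
          rw [Finset.sum_comm]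
          exact Finset.sum_congr rfl fun a _ => Finset.sum_congr rfl fun t _ => by ring
      _ = 0 := by simp [integ_monVec hl]
  calc integ τ.lamMeas l
      = l.sum (fun t c => Finsupp.single t c) - ∑ j, Finsupp.single (τ.pt j)
          (integ (fun t => ((nodeMat τ.pt)⁻¹.mulVec (monVec t)) j) l) := by
        simp only [integ, Finsupp.sum, Nodes.lamMeas, smul_sub, Finset.sum_sub_distrib,
          Finset.smul_sum, Finsupp.smul_single, smul_eq_mul, mul_one, Finsupp.single_finsetSum]
        rw [Finset.sum_comm]
    _ = l := by simp [hz]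

/-- Every `λ ∈ Λ_k` is the combination `∑ᵢ cᵢ λ_{tᵢ}`, if `λ = ∑ᵢ cᵢ δ_{tᵢ}`. -/
theorem integ_lam_eq_self (τ : Nodes d k) (l : Lam d k) : integ τ.lam l.1 = l := by
  apply Subtype.ext
  refine Eq.trans ?_ (integ_lamMeas_eq_self τ l.2)
  unfold integ
  rw [Finsupp.sum, AddSubmonoidClass.coe_finsetSum]
  rfl

theorem integ_integ_moveMeas_lamMeas (τ : Nodes d k) (g : E d → V) (w : E d) (r : ℝ)
    {l : FinMeas d} (hl : l ∈ Lam d k) :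
    integ (fun t => integ g (moveMeas w r (τ.lamMeas t))) l = integ g (moveMeas w r l) := by
  let L : FinMeas d →ₗ[ℂ] V :=
    Finsupp.linearCombination ℂ g ∘ₗ Finsupp.lmapDomain ℂ ℂ (fun u => w + r • u)
  show integ (fun t => L (τ.lamMeas t)) l = L l
  conv_rhs => rw [← integ_lamMeas_eq_self τ hl]
  unfold integ
  rw [map_finsuppSum]
  simp only [map_smul]

variable [MetricSpace V]

/-- A field is recovered from its representation by integration. -/
theorem Sc.apply_eq_integ {τ : Nodes d k} (f : Sc τ V) (l : Lam d k) : f l = integ f.rep l.1 := by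
  conv_lhs => rw [← integ_lam_eq_self τ l]
  unfold integ
  rw [map_finsuppSum]
  simp only [map_smul]
  rfl

theorem Sc.continuous_rep {τ : Nodes d k} : Continuous (Sc.rep : Sc τ V → C(E d, V)) :=
  continuous_induced_dom

/-- A field that is not almost surely zero has no almost surely zero translate or dilate. -/
theorem Sc.exists_not_ae_eq_zero {τ : Nodes d k} {Ω : Type*}
    [MeasurableSpace Ω] {P : Measure Ω} {Y : Ω → Sc τ V} (hY : ¬ ∀ᵐ ω ∂P, ∀ l, Y ω l = 0)
    (w : E d) {r : ℝ} (hr : r ≠ 0) : ∃ l : Lam d k, ¬ ∀ᵐ ω ∂P, Y ω (move w r l) = 0 := by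
  by_contra! h
  have h' : ∀ l : Lam d k, ∀ᵐ ω ∂P, Y ω l = 0 := by
    intro l
    have h1 := h (move (-(r⁻¹ • w)) r⁻¹ l)
    rw [move_move] at h1
    have h2 : move (w + r • -(r⁻¹ • w)) (r * r⁻¹) l = l := by
      rw [smul_neg, smul_inv_smul₀ hr, add_neg_cancel, mul_inv_cancel₀ hr]
      exact Subtype.ext (moveMeas_zero_one _)
    rwa [h2] at h1
  apply hY
  have h3 : ∀ᵐ ω ∂P, ∀ n, Y ω (τ.lam (TopologicalSpace.denseSeq (E d) n)) = 0 :=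
    ae_all_iff.2 fun n => h' _
  filter_upwards [h3] with ω hω l
  have h4 : ((Y ω).rep : E d → V) = fun _ => 0 :=
    (TopologicalSpace.denseRange_denseSeq (E d)).equalizer (Y ω).rep.continuous continuous_const
      (funext hω)
  rw [Sc.apply_eq_integ, h4]
  simp [integ]

variable [IsTopologicalAddGroup V] [ContinuousSMul ℂ V]

theorem continuous_integ_moveMeas (l : FinMeas d) :
    Continuous fun p : (E d × ℝ) × C(E d, V) => integ p.2 (moveMeas p.1.1 p.1.2 l) := by
  simp only [integ_moveMeas]
  exact continuous_finsetSum _ fun t _ => by fun_prop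

theorem tendsto_integ_moveMeas {w : ℕ → E d} {r : ℕ → ℝ} {w₀ : E d} {r₀ : ℝ}
    (hw : Tendsto w atTop (𝓝 w₀)) (hr : Tendsto r atTop (𝓝 r₀)) (l : FinMeas d)
    (g : C(E d, V)) :
    Tendsto (fun p : ℕ × C(E d, V) => integ p.2 (moveMeas (w p.1) (r p.1) l)) (atTop ×ˢ 𝓝 g)
      (𝓝 (integ g (moveMeas w₀ r₀ l))) := by
  have h1 := (continuous_integ_moveMeas (V := V) l).tendsto ((w₀, r₀), g)
  have h2 : Tendsto (fun p : ℕ × C(E d, V) => ((w p.1, r p.1), p.2)) (atTop ×ˢ 𝓝 g)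
      (𝓝 ((w₀, r₀), g)) :=
    ((hw.comp tendsto_fst).prodMk_nhds (hr.comp tendsto_fst)).prodMk_nhds tendsto_snd
  simpa only [Function.comp_def] using h1.comp h2

theorem continuous_integ (l : FinMeas d) : Continuous fun g : C(E d, V) => integ g l := by
  exact continuous_finsetSum _ fun t _ => by fun_prop

theorem continuous_monVec (a : MonIdx d k) : Continuous fun t : E d => monVec t a := by
  unfold monVec
  fun_prop

theorem continuous_integ_moveMeas_lamMeas (τ : Nodes d k) :
    Continuous fun p : ((E d × ℝ) × C(E d, V)) × E d =>
      integ p.1.2 (moveMeas p.1.1.1 p.1.1.2 (τ.lamMeas p.2)) := by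
  simp only [integ_moveMeas, integ_lamMeas]
  refine Continuous.sub (by fun_prop) (continuous_finsetSum _ fun j _ => ?_)
  refine Continuous.smul ?_ (by fun_prop)
  simp only [Matrix.mulVec, dotProduct]
  exact continuous_finsetSum _ fun a _ =>
    continuous_const.mul ((continuous_monVec a).comp continuous_snd)

/-- The path `t ↦ ∫ g d(w + r·λ_t)`. If `g` represents a field `f`, it represents the
field `λ ↦ f(w + r·λ)`. -/
noncomputable def pathMove (τ : Nodes d k) (w : E d) (r : ℝ) (g : C(E d, V)) : C(E d, V) where
  toFun t := integ g (moveMeas w r (τ.lamMeas t))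
  continuous_toFun := by
    have hφ : Continuous fun t : E d => ((((w, r), g), t) : ((E d × ℝ) × C(E d, V)) × E d) :=
      Continuous.prodMk continuous_const continuous_id
    have h := (continuous_integ_moveMeas_lamMeas (V := V) τ).comp hφ
    simp only [Function.comp_def] at h
    exact h

theorem continuous_pathMove_apply (τ : Nodes d k) :
    Continuous fun p : ((E d × ℝ) × C(E d, V)) × E d =>
      pathMove τ p.1.1.1 p.1.1.2 p.1.2 p.2 :=
  continuous_integ_moveMeas_lamMeas τ

theorem continuous_pathMove (τ : Nodes d k) (w : E d) (r : ℝ) :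
    Continuous fun g : C(E d, V) => pathMove τ w r g := by
  refine ContinuousMap.continuous_of_continuous_uncurry _ ?_
  have h1 : Continuous fun p : C(E d, V) × E d => (((w, r), p.1), p.2) := by fun_prop
  have h2 := (continuous_pathMove_apply (V := V) τ).comp h1
  simp only [Function.comp_def] at h2
  exact h2

theorem integ_pathMove (τ : Nodes d k) (w : E d) (r : ℝ) (g : C(E d, V)) {l : FinMeas d}
    (hl : l ∈ Lam d k) : integ (pathMove τ w r g) l = integ g (moveMeas w r l) :=
  integ_integ_moveMeas_lamMeas τ g w r hl

theorem Sc.pathMove_rep_apply {τ : Nodes d k} (f : Sc τ V) (w : E d) (r : ℝ) (t : E d) :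
    pathMove τ w r f.rep t = f (move w r (τ.lam t)) :=
  (f.apply_eq_integ (move w r (τ.lam t))).symm

end PathSpace

namespace IsScalingAction

variable {V : Type*} [AddCommGroup V] [MetricSpace V] {T : ℝ → V → V} (hT : IsScalingAction T)
include hT

theorem inv_apply_apply {a : ℝ} (ha : 0 < a) (x : V) : T a⁻¹ (T a x) = x := by
  rw [hT.comp _ _ (inv_pos.2 ha) ha, inv_mul_cancel₀ ha.ne', hT.one]

theorem continuousAt {a : ℝ} (ha : 0 < a) (x : V) :
    ContinuousAt (fun p : ℝ × V => T p.1 p.2) (a, x) := by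
  refine tendsto_of_seq_tendsto fun u hu => ?_
  have h1 : Tendsto (fun n => (u n).1) atTop (𝓝 a) := (continuous_fst.tendsto _).comp hu
  have h2 : Tendsto (fun n => (u n).2) atTop (𝓝 x) := (continuous_snd.tendsto _).comp hu
  have h3 : ∀ᶠ n in atTop, 0 < (u n).1 := h1.eventually (lt_mem_nhds ha)
  have h4 : (fun n => if 0 < (u n).1 then (u n).1 else a) =ᶠ[atTop] fun n => (u n).1 := by
    filter_upwards [h3] with n hn using if_pos hn
  refine (hT.continuous _ a _ x (fun n => ?_) ha (h1.congr' h4.symm) h2).congr' ?_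
  · split_ifs with h
    exacts [h, ha]
  · filter_upwards [h4] with n hn
    rw [hn]
    rfl

theorem tendsto {ι : Type*} {L : Filter ι} {a : ι → ℝ} {x : ι → V} {a₀ : ℝ} {x₀ : V} (h₀ : 0 < a₀)
    (ha : Tendsto a L (𝓝 a₀)) (hx : Tendsto x L (𝓝 x₀)) :
    Tendsto (fun i => T (a i) (x i)) L (𝓝 (T a₀ x₀)) :=
  (hT.continuousAt h₀ x₀).tendsto.comp (ha.prodMk_nhds hx)

theorem continuous_apply {a : ℝ} (ha : 0 < a) : Continuous (T a) :=
  continuous_iff_continuousAt.2 fun _ => hT.tendsto ha tendsto_const_nhds tendsto_id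

/-- A scaling action extends continuously by `T 0 = 0` to the scale `0`. -/
theorem tendsto_zero {ι : Type*} {L : Filter ι} {a : ι → ℝ} {x : ι → V} {x₀ : V}
    (ha : Tendsto a L (𝓝[>] 0)) (hx : Tendsto x L (𝓝 x₀)) :
    Tendsto (fun i => T (a i) (x i)) L (𝓝 0) := by
  refine Metric.tendsto_nhds.2 fun ε hε => ?_
  obtain ⟨δ, hδ, hδ0⟩ :=
    (((hT.small x₀).eventually (gt_mem_nhds hε)).and self_mem_nhdsWithin).exists
  have h1 := ((hT.continuous_apply hδ0).tendsto x₀).comp hx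
  have h2 : ∀ᶠ i in L, dist (T δ (x i)) 0 < ε :=
    (h1.dist tendsto_const_nhds).eventually (gt_mem_nhds hδ)
  filter_upwards [h2, ha (Ioo_mem_nhdsGT hδ0)] with i hi hai
  obtain h0 | h0 := eq_or_ne (x i) 0
  · rw [h0, hT.zero _ hai.1, dist_self]
    exact hε
  · exact (hT.radial _ h0 _ _ hai.1 hai.2).trans hi

/-- Two different scalings of a random element have different laws unless it vanishes: the
expectation of the arctangent of the distance to `0`, a bounded strictly increasing function of
it, separates them. -/
theorem ae_eq_zero_of_lt [MeasurableSpace V] [BorelSpace V] {Ω : Type*} [MeasurableSpace Ω]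
    {P : Measure Ω} [IsFiniteMeasure P] {ξ : Ω → V} {a b : ℝ} (ha : 0 < a) (hab : a < b)
    (h : IdentDistrib (fun ω => T a (ξ ω)) (fun ω => T b (ξ ω)) P P) : ∀ᵐ ω ∂P, ξ ω = 0 := by
  let φ : V → ℝ := fun x => Real.arctan (dist x 0)
  have hφ : Continuous φ := Real.continuous_arctan.comp (by fun_prop)
  have h1 := (h.comp hφ.measurable).integral_eq
  have hb : ∀ x, ‖φ x‖ ≤ Real.pi / 2 := fun x =>
    abs_le.2 ⟨(Real.neg_pi_div_two_lt_arctan _).le, (Real.arctan_lt_pi_div_two _).le⟩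
  have hle : ∀ ω, φ (T a (ξ ω)) ≤ φ (T b (ξ ω)) := by
    intro ω
    obtain h0 | h0 := eq_or_ne (ξ ω) 0
    · rw [h0, hT.zero _ ha, hT.zero _ (ha.trans hab)]
    · exact Real.arctan_strictMono.monotone (hT.radial _ h0 _ _ ha hab).le
  have hi : ∀ {η : Ω → V}, AEMeasurable η P → Integrable (fun ω => φ (η ω)) P := fun hη =>
    Integrable.of_bound (hφ.measurable.comp_aemeasurable hη).aestronglyMeasurable _
      (Eventually.of_forall fun ω => hb _)
  have h2 := (integral_eq_iff_of_ae_le (hi h.aemeasurable_fst) (hi h.aemeasurable_snd)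
    (Eventually.of_forall hle)).1 h1
  filter_upwards [h2] with ω hω
  by_contra h0
  exact (Real.arctan_strictMono (hT.radial _ h0 _ _ ha hab)).ne hω

theorem eq_of_identDistrib [MeasurableSpace V] [BorelSpace V] {Ω : Type*} [MeasurableSpace Ω]
    {P : Measure Ω} [IsFiniteMeasure P] {ξ : Ω → V} {a b : ℝ} (ha : 0 < a) (hb : 0 < b)
    (h : IdentDistrib (fun ω => T a (ξ ω)) (fun ω => T b (ξ ω)) P P)
    (hξ : ¬ ∀ᵐ ω ∂P, ξ ω = 0) : a = b := by
  rcases lt_trichotomy a b with hab | hab | hab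
  · exact (hξ (hT.ae_eq_zero_of_lt ha hab h)).elim
  · exact hab
  · exact (hξ (hT.ae_eq_zero_of_lt hb hab h.symm)).elim

end IsScalingAction

/-! ### Convergence of types -/

section Types

variable {d : ℕ} (k : ℤ) {V : Type*} [AddCommGroup V] [Module ℂ V] [MetricSpace V]
  [MeasurableSpace V] [BorelSpace V] {Ω Ω' : Type*} [MeasurableSpace Ω] [MeasurableSpace Ω']

/-- For every `λ ∈ Λ_k`, the law of `∫ Z dλ` is also that of `T_a(∫ Z d(w + r·λ))`. -/
def IsLawInvariant (P' : Measure Ω') (Z : Ω' → C(E d, V)) (T : ℝ → V → V) (w : E d) (r a : ℝ) :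
    Prop :=
  ∀ l : Lam d k, IdentDistrib (fun ω => T a (integ (Z ω) (moveMeas w r l)))
    (fun ω => integ (Z ω) (l : FinMeas d)) P' P'

variable {k} {P' : Measure Ω'} {Z : Ω' → C(E d, V)} {T : ℝ → V → V}

/-- The triples `(w, r, a)` leaving the law invariant are closed under composition. -/
theorem IsLawInvariant.comp (hT : IsScalingAction T) {w w' : E d} {r r' a a' : ℝ}
    (ha : 0 < a) (ha' : 0 < a') (h : IsLawInvariant k P' Z T w r a)
    (h' : IsLawInvariant k P' Z T w' r' a') :
    IsLawInvariant k P' Z T (w' + r' • w) (r' * r) (a * a') := by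
  intro l
  have h1 := (h' (move w r l)).comp (hT.continuous_apply ha).measurable
  have h2 := h1.trans (h l)
  convert h2 using 2 with ω
  show _ = T a (T a' (integ (Z ω) (moveMeas w' r' (moveMeas w r l))))
  rw [moveMeas_moveMeas, hT.comp _ _ ha ha']

/-- If the law is invariant, up to scaling, under the dilation by `2`, then a translation that
leaves it invariant up to scaling by `a` has `a = 1`: the map `u ↦ 2w + 2u` is both the dilation
after the translation, which costs one factor `a`, and the dilation followed by two translations,
which costs `a²`. -/
theorem IsLawInvariant.eq_one [IsFiniteMeasure P'] (hT : IsScalingAction T)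
    (hZ : ∀ w : E d, ∀ r : ℝ, 0 < r →
      ∃ l : Lam d k, ¬ ∀ᵐ ω ∂P', integ (Z ω) (moveMeas w r l) = 0)
    {w : E d} {a b : ℝ} (ha : 0 < a) (hb : 0 < b) (h : IsLawInvariant k P' Z T w 1 a)
    (h2 : IsLawInvariant k P' Z T 0 2 b) : a = 1 := by
  have h3 : IsLawInvariant k P' Z T ((2 : ℝ) • w) 2 (a * b) := by
    simpa using IsLawInvariant.comp hT ha hb h h2
  have h4 : IsLawInvariant k P' Z T ((2 : ℝ) • w) 2 (b * a * a) := by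
    have h5 : IsLawInvariant k P' Z T w 2 (b * a) := by
      simpa using IsLawInvariant.comp hT hb ha h2 h
    simpa [two_smul] using IsLawInvariant.comp hT (mul_pos hb ha) ha h5 h
  obtain ⟨l, hl⟩ := hZ ((2 : ℝ) • w) 2 two_pos
  have h6 := hT.eq_of_identDistrib (mul_pos ha hb) (mul_pos (mul_pos hb ha) ha)
    ((h3 l).trans (h4 l).symm) hl
  have h7 : a * b ≠ 0 := (mul_pos ha hb).ne'
  have h8 : a * b * 1 = a * b * a := by linarith
  exact (mul_left_cancel₀ h7 h8).symm

variable [IsTopologicalAddGroup V] [ContinuousSMul ℂ V] [MeasurableSpace C(E d, V)]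
  [BorelSpace C(E d, V)] {P : Measure Ω} [IsProbabilityMeasure P] [IsProbabilityMeasure P']

/-- The extended continuous mapping theorem for the functionals `g ↦ Aₙ(∫ g d(wₙ + rₙ·λ))`. -/
theorem tendstoInDistribution_scaled {X : ℕ → Ω → C(E d, V)}
    (hX : TendstoInDistribution X atTop Z (fun _ => P) P') {w : ℕ → E d} {r : ℕ → ℝ} {w₀ : E d}
    {r₀ : ℝ} (l : FinMeas d) {A : ℕ → V → V} {A₀ : V → V} (hA₀ : Continuous A₀)
    (hA : ∀ n, Continuous (A n))
    (h : ∀ g : C(E d, V), Tendsto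
      (fun p : ℕ × C(E d, V) => A p.1 (integ p.2 (moveMeas (w p.1) (r p.1) l))) (atTop ×ˢ 𝓝 g)
      (𝓝 (A₀ (integ g (moveMeas w₀ r₀ l))))) :
    TendstoInDistribution (fun n ω => A n (integ (X n ω) (moveMeas (w n) (r n) l))) atTop
      (fun ω => A₀ (integ (Z ω) (moveMeas w₀ r₀ l))) (fun _ => P) P' := by
  have h1 : ∀ (w : E d) (r : ℝ), Measurable fun g : C(E d, V) => integ g (moveMeas w r l) :=
    fun w r => (continuous_integ (moveMeas w r l)).measurable
  exact tendstoInDistribution_extended_comp hX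
    (g := fun n g => A n (integ g (moveMeas (w n) (r n) l)))
    (g₀ := fun g => A₀ (integ g (moveMeas w₀ r₀ l))) h
    (fun n => ((hA n).measurable.comp (h1 _ _)).comp_aemeasurable (hX.forall_aemeasurable n))
    ((hA₀.measurable.comp (h1 _ _)).comp_aemeasurable hX.aemeasurable_limit)

/-- Convergence of types. If the moved paths `Xₙ(wₙ + r₀·)` and their scalings by `aₙ` both
converge in law to nonzero limits, then `aₙ` stays away from `0` and `∞`, and any of its limit
points relates the two limits. -/
theorem exists_subseq_isLawInvariant (hT : IsScalingAction T) {X : ℕ → Ω → C(E d, V)}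
    (hX : TendstoInDistribution X atTop Z (fun _ => P) P')
    (hZ : ∀ w : E d, ∀ r : ℝ, 0 < r →
      ∃ l : Lam d k, ¬ ∀ᵐ ω ∂P', integ (Z ω) (moveMeas w r l) = 0)
    {w : ℕ → E d} {w₀ : E d} (hw : Tendsto w atTop (𝓝 w₀)) {r₀ : ℝ} (hr₀ : 0 < r₀)
    {a : ℕ → ℝ} (ha : ∀ n, 0 < a n)
    (hW : ∀ l : Lam d k, TendstoInDistribution
      (fun n ω => T (a n) (integ (X n ω) (moveMeas (w n) r₀ l))) atTop
      (fun ω => integ (Z ω) (l : FinMeas d)) (fun _ => P) P') :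
    ∃ φ : ℕ → ℕ, StrictMono φ ∧ ∃ a₀, 0 < a₀ ∧ Tendsto (a ∘ φ) atTop (𝓝 a₀) ∧
      IsLawInvariant k P' Z T w₀ r₀ a₀ := by
  obtain ⟨α, φ, hφ, hα⟩ := CompactSpace.tendsto_subseq fun n => ENNReal.ofReal (a n)
  have hφt := hφ.tendsto_atTop
  have hXφ := tendstoInDistribution_comp_subseq hX hφt
  have hWφ := fun l => tendstoInDistribution_comp_subseq (hW l) hφt
  have hU : ∀ (l : FinMeas d) (g : C(E d, V)), Tendsto
      (fun p : ℕ × C(E d, V) => integ p.2 (moveMeas (w (φ p.1)) r₀ l)) (atTop ×ˢ 𝓝 g)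
      (𝓝 (integ g (moveMeas w₀ r₀ l))) :=
    fun l g => tendsto_integ_moveMeas (hw.comp hφt) tendsto_const_nhds l g
  have hreal : α ≠ ⊤ → Tendsto (a ∘ φ) atTop (𝓝 α.toReal) := fun h => by
    have h1 := (ENNReal.tendsto_toReal h).comp hα
    refine h1.congr fun n => ?_
    simp [(ha _).le]
  obtain rfl | htop := eq_or_ne α ⊤
  · -- If `aₙ → ∞`, undoing the scaling forces the limit of the moved paths to vanish.
    exfalso
    have h1 : Tendsto (fun n => (a (φ n))⁻¹) atTop (𝓝[>] 0) := by
      refine tendsto_nhdsWithin_iff.2 ⟨?_, Eventually.of_forall fun n => inv_pos.2 (ha _)⟩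
      have h2 := (ENNReal.tendsto_toReal (by simp : (⊤ : ℝ≥0∞)⁻¹ ≠ ⊤)).comp
        ((continuous_inv.tendsto _).comp hα)
      simp only [ENNReal.inv_top, ENNReal.toReal_zero] at h2
      refine h2.congr fun n => ?_
      simp [ENNReal.toReal_inv, (ha _).le]
    obtain ⟨l, hl⟩ := hZ w₀ r₀ hr₀
    have h3 : TendstoInDistribution (fun n ω => T (a (φ n))⁻¹
        (T (a (φ n)) (integ (X (φ n) ω) (moveMeas (w (φ n)) r₀ l)))) atTop
        (fun _ : Ω' => (0 : V)) (fun _ => P) P' :=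
      tendstoInDistribution_extended_comp (hWφ l) (g := fun n x => T (a (φ n))⁻¹ x)
        (g₀ := fun _ => 0) (fun x => hT.tendsto_zero (h1.comp tendsto_fst) tendsto_snd)
        (fun n => (hT.continuous_apply (inv_pos.2 (ha _))).measurable.comp_aemeasurable
          ((hWφ l).forall_aemeasurable n)) aemeasurable_const
    simp only [hT.inv_apply_apply (ha _)] at h3
    have h4 := tendstoInDistribution_scaled hXφ (w := fun n => w (φ n)) (r := fun _ => r₀)
      (w₀ := w₀) (r₀ := r₀) (l : FinMeas d) (A := fun _ x => x) (A₀ := fun x => x) continuous_id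
      (fun _ => continuous_id) (hU l)
    exact hl (ae_eq_zero_of_tendstoInDistribution h4 h3)
  obtain rfl | h0 := eq_or_ne α 0
  · -- If `aₙ → 0`, the limit of the scaled paths vanishes.
    exfalso
    obtain ⟨l, hl⟩ := hZ 0 1 one_pos
    simp only [moveMeas_zero_one] at hl
    have h1 : Tendsto (fun n => a (φ n)) atTop (𝓝[>] 0) :=
      tendsto_nhdsWithin_iff.2 ⟨hreal htop, Eventually.of_forall fun n => ha _⟩
    have h2 := tendstoInDistribution_scaled hXφ (w := fun n => w (φ n)) (r := fun _ => r₀)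
      (w₀ := w₀) (r₀ := r₀) (l : FinMeas d) (A := fun n => T (a (φ n)))
      (A₀ := fun _ => 0) continuous_const (fun n => hT.continuous_apply (ha _))
      fun g => hT.tendsto_zero (h1.comp tendsto_fst) (hU l g)
    exact hl (ae_eq_zero_of_tendstoInDistribution (hWφ l) h2)
  · have hpos := ENNReal.toReal_pos h0 htop
    refine ⟨φ, hφ, α.toReal, hpos, hreal htop, fun l => ?_⟩
    have h1 := tendstoInDistribution_scaled hXφ (w := fun n => w (φ n)) (r := fun _ => r₀)
      (w₀ := w₀) (r₀ := r₀) l (A := fun n => T (a (φ n)))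
      (A₀ := T α.toReal) (hT.continuous_apply hpos) (fun n => hT.continuous_apply (ha _))
      fun g => hT.tendsto hpos ((hreal htop).comp tendsto_fst) (hU l g)
    exact ⟨h1.aemeasurable_limit, (hWφ l).aemeasurable_limit,
      tendstoInDistribution_unique _ h1 (hWφ l)⟩

/-- If the paths `Xₙ`, the scaled dilates `T_{bₙ} Xₙ(2·)` and the scaled translates
`T_{aₙ} Xₙ(wₙ + ·)` have the same limit in law, then `aₙ → 1`. -/
theorem tendsto_scaling_one (hT : IsScalingAction T) {X : ℕ → Ω → C(E d, V)}
    (hX : TendstoInDistribution X atTop Z (fun _ => P) P')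
    (hZ : ∀ w : E d, ∀ r : ℝ, 0 < r →
      ∃ l : Lam d k, ¬ ∀ᵐ ω ∂P', integ (Z ω) (moveMeas w r l) = 0)
    {b : ℕ → ℝ} (hb : ∀ n, 0 < b n)
    (hb2 : ∀ l : Lam d k, TendstoInDistribution
      (fun n ω => T (b n) (integ (X n ω) (moveMeas 0 2 l))) atTop
      (fun ω => integ (Z ω) (l : FinMeas d)) (fun _ => P) P')
    {w : ℕ → E d} {w₀ : E d} (hw : Tendsto w atTop (𝓝 w₀)) {a : ℕ → ℝ} (ha : ∀ n, 0 < a n)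
    (hW : ∀ l : Lam d k, TendstoInDistribution
      (fun n ω => T (a n) (integ (X n ω) (moveMeas (w n) 1 l))) atTop
      (fun ω => integ (Z ω) (l : FinMeas d)) (fun _ => P) P') :
    Tendsto a atTop (𝓝 1) := by
  obtain ⟨-, -, b₀, hb₀, -, hinv⟩ := exists_subseq_isLawInvariant hT hX hZ
    (w := fun _ => 0) tendsto_const_nhds two_pos hb hb2
  refine tendsto_of_subseq_tendsto fun ns hns => ?_
  obtain ⟨φ, -, a₀, ha₀, hlim, hinv'⟩ := exists_subseq_isLawInvariant hT
    (tendstoInDistribution_comp_subseq hX hns) hZ (hw.comp hns) one_pos (fun n => ha (ns n))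
    fun l => tendstoInDistribution_comp_subseq (hW l) hns
  refine ⟨φ, ?_⟩
  rwa [← hinv'.eq_one hT hZ ha₀ hb₀ hinv]

end Types

/-! ### Near-constancy sets and moved paths -/

/-- For `p = (i, j, N, q)`: the points of `B` at which `F i n` is within `1/(j+1)` of the rational
number `q` for all `n ≥ N`. Wherever `F i n` converges, every `j` has a point in such a set,
and on one such set the convergence is uniform and the limit nearly constant, up to `2/(j+1)`. -/
def nearConstSet {α : Type*} (F : ℕ → ℕ → α → ℝ) (B : Set α) (p : ℕ × ℕ × ℕ × ℚ) : Set α :=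
  {s ∈ B | ∀ n ≥ p.2.2.1, |F p.1 n s - p.2.2.2| ≤ ((p.2.1 : ℝ) + 1)⁻¹}

theorem exists_mem_nearConstSet {α : Type*} {F : ℕ → ℕ → α → ℝ} {B : Set α} {s : α} (hs : s ∈ B)
    {i : ℕ} {L : ℝ} (h : Tendsto (fun n => F i n s) atTop (𝓝 L)) (j : ℕ) :
    ∃ (N : ℕ) (q : ℚ), s ∈ nearConstSet F B (i, j, N, q) := by
  have hε : (0 : ℝ) < ((j : ℝ) + 1)⁻¹ / 2 := by positivity
  obtain ⟨q, hq⟩ := Rat.denseRange_cast (𝕜 := ℝ) |>.exists_dist_lt L hε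
  obtain ⟨N, hN⟩ := Metric.tendsto_atTop.1 h _ hε
  refine ⟨N, q, hs, fun n hn => ?_⟩
  have h1 := dist_triangle (F i n s) L q
  rw [← Real.dist_eq]
  linarith [hN n hn]

theorem abs_sub_le_of_mem_nearConstSet {α : Type*} {F : ℕ → ℕ → α → ℝ} {B : Set α} {s t : α}
    {i j N : ℕ} {q : ℚ} (hs : s ∈ nearConstSet F B (i, j, N, q))
    (ht : t ∈ nearConstSet F B (i, j, N, q)) {L : ℝ}
    (h : Tendsto (fun n => F i n s) atTop (𝓝 L)) {n : ℕ} (hn : N ≤ n) :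
    |F i n t - L| ≤ 2 * ((j : ℝ) + 1)⁻¹ := by
  have h1 : |L - q| ≤ ((j : ℝ) + 1)⁻¹ :=
    le_of_tendsto ((h.sub_const (q : ℝ)).abs) (eventually_atTop.2 ⟨N, hs.2⟩)
  have h2 := abs_sub_le (F i n t) q L
  have h3 := ht.2 n hn
  rw [abs_sub_comm (q : ℝ) L] at h2
  simp only at h3
  linarith

theorem measurableSet_nearConstSet {α : Type*} [MeasurableSpace α] {F : ℕ → ℕ → α → ℝ} {B : Set α}
    (hB : MeasurableSet B) (hF : ∀ i n, Measurable fun s : B => F i n s) (p : ℕ × ℕ × ℕ × ℚ) :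
    MeasurableSet (nearConstSet F B p) := by
  have h1 : MeasurableSet
      {s : B | ∀ n ≥ p.2.2.1, |F p.1 n s - p.2.2.2| ≤ ((p.2.1 : ℝ) + 1)⁻¹} := by
    simp only [Set.ofPred_forall]
    refine MeasurableSet.iInter fun n => MeasurableSet.iInter fun _ => ?_
    exact measurableSet_le ((hF p.1 n).sub_const _).abs measurable_const
  convert hB.subtype_image h1 using 1
  ext s
  simp [nearConstSet, and_comm]

/-- The sequential definition of `A_n → I` amounts to convergence along `atTop ×ˢ 𝓝 x`. -/
theorem TendstoToId.tendsto_prod {V : Type*} [MetricSpace V] {A : ℕ → V → V}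
    (hA : TendstoToId A) (x : V) :
    Tendsto (fun p : ℕ × V => A p.1 p.2) (atTop ×ˢ 𝓝 x) (𝓝 x) := by
  refine tendsto_of_subseq_tendsto fun u hu => ?_
  have h1 : Tendsto (fun n => (u n).1) atTop atTop := tendsto_fst.comp hu
  have h2 : Tendsto (fun n => (u n).2) atTop (𝓝 x) := tendsto_snd.comp hu
  obtain ⟨φ, hφ, hmono⟩ := strictMono_subseq_of_tendsto_atTop h1
  refine ⟨φ, ?_⟩
  classical
  -- `A_n → I` speaks of sequences indexed by all `n`: the missing terms are set to `x`.
  let ψ : ℕ → ℕ := fun n => (u (φ n)).1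
  let y : ℕ → V := Function.extend ψ (fun n => (u (φ n)).2) fun _ => x
  have hy : Tendsto y atTop (𝓝 x) := by
    refine Metric.tendsto_atTop.2 fun ε hε => ?_
    obtain ⟨N, hN⟩ := Metric.tendsto_atTop.1 (h2.comp hφ.tendsto_atTop) ε hε
    refine ⟨ψ N, fun n hn => ?_⟩
    by_cases hex : ∃ m, ψ m = n
    · obtain ⟨m, rfl⟩ := hex
      rw [show y (ψ m) = (u (φ m)).2 from hmono.injective.extend_apply _ _ _]
      exact hN m (hmono.le_iff_le.1 hn)
    · rw [show y n = x from Function.extend_apply' _ _ _ hex, dist_self]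
      exact hε
  refine ((hA y x hy).comp hmono.tendsto_atTop).congr fun n => ?_
  show A (ψ n) (y (ψ n)) = _
  rw [show y (ψ n) = (u (φ n)).2 from hmono.injective.extend_apply _ _ _]

section

variable {d : ℕ} {k : ℤ} {τ : Nodes d k} {V : Type*} [AddCommGroup V] [Module ℂ V]
  [MetricSpace V] [IsTopologicalAddGroup V] [ContinuousSMul ℂ V]

/-- If `A_n → I` and `wₙ → w₀`, then `A_n(g_n(wₙ + ·)) → g(w₀ + ·)` locally uniformly whenever
`g_n → g` locally uniformly. -/
theorem tendsto_comp_pathMove {A : ℕ → C(V, V)} (hA : ∀ x, Tendsto (fun p : ℕ × V => A p.1 p.2)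
      (atTop ×ˢ 𝓝 x) (𝓝 x)) {w : ℕ → E d} {w₀ : E d} (hw : Tendsto w atTop (𝓝 w₀))
    (g : C(E d, V)) :
    Tendsto (fun p : ℕ × C(E d, V) => (A p.1).comp (pathMove τ (w p.1) 1 p.2)) (atTop ×ˢ 𝓝 g)
      (𝓝 (pathMove τ w₀ 1 g)) := by
  rw [ContinuousMap.tendsto_iff_tendstoLocallyUniformly,
    tendstoLocallyUniformly_iff_forall_tendsto]
  intro t
  have h1 : Tendsto (fun y : (ℕ × C(E d, V)) × E d => pathMove τ w₀ 1 g y.2)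
      ((atTop ×ˢ 𝓝 g) ×ˢ 𝓝 t) (𝓝 (pathMove τ w₀ 1 g t)) :=
    ((pathMove τ w₀ 1 g).continuous.tendsto t).comp tendsto_snd
  have h2 : Tendsto (fun y : (ℕ × C(E d, V)) × E d => pathMove τ (w y.1.1) 1 y.1.2 y.2)
      ((atTop ×ˢ 𝓝 g) ×ˢ 𝓝 t) (𝓝 (pathMove τ w₀ 1 g t)) := by
    have h3 := (continuous_pathMove_apply (V := V) τ).tendsto (((w₀, 1), g), t)
    have h4 : Tendsto (fun y : (ℕ × C(E d, V)) × E d => (((w y.1.1, (1 : ℝ)), y.1.2), y.2))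
        ((atTop ×ˢ 𝓝 g) ×ˢ 𝓝 t) (𝓝 (((w₀, 1), g), t)) :=
      (((hw.comp (tendsto_fst.comp tendsto_fst)).prodMk_nhds tendsto_const_nhds).prodMk_nhds
        (tendsto_snd.comp tendsto_fst)).prodMk_nhds tendsto_snd
    simpa only [Function.comp_def] using h3.comp h4
  have h5 : Tendsto (fun y : (ℕ × C(E d, V)) × E d =>
      A y.1.1 (pathMove τ (w y.1.1) 1 y.1.2 y.2)) ((atTop ×ˢ 𝓝 g) ×ˢ 𝓝 t)
      (𝓝 (pathMove τ w₀ 1 g t)) := by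
    have h6 : Tendsto (fun y : (ℕ × C(E d, V)) × E d =>
        (y.1.1, pathMove τ (w y.1.1) 1 y.1.2 y.2)) ((atTop ×ˢ 𝓝 g) ×ˢ 𝓝 t)
        (atTop ×ˢ 𝓝 (pathMove τ w₀ 1 g t)) :=
      (tendsto_fst.comp tendsto_fst).prodMk h2
    simpa only [Function.comp_def] using (hA (pathMove τ w₀ 1 g t)).comp h6
  exact (h1.prodMk_nhds h5).mono_right (nhds_le_uniformity _)

/-- The path `t ↦ T_a(∫ g d(s + r·λ_t))` depends continuously on `a > 0`, `s` and `g`. -/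
theorem continuous_scaled_pathMove (τ : Nodes d k) {T : ℝ → V → V} (hT : IsScalingAction T)
    (r : ℝ) :
    ∃ Φ : (Set.Ioi (0 : ℝ) × E d) × C(E d, V) → C(E d, V), Continuous Φ ∧
      ∀ a s g t, Φ ((a, s), g) t = T a (pathMove τ s r g t) := by
  refine ⟨fun p => ⟨fun t => T p.1.1 (pathMove τ p.1.2 r p.2 t),
    (hT.continuous_apply p.1.1.2).comp (pathMove τ p.1.2 r p.2).continuous⟩,
    ContinuousMap.continuous_of_continuous_uncurry _ ?_, fun a s g t => rfl⟩
  have h3 := continuous_pathMove_apply (V := V) τ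
  have h4 : Continuous fun y : ((Set.Ioi (0 : ℝ) × E d) × C(E d, V)) × E d =>
      (((y.1.1.2, r), y.1.2), y.2) := by fun_prop
  have h5 : Continuous fun y : ((Set.Ioi (0 : ℝ) × E d) × C(E d, V)) × E d =>
      pathMove τ y.1.1.2 r y.1.2 y.2 := by
    simpa only [Function.comp_def] using h3.comp h4
  refine continuous_iff_continuousAt.2 fun y => ?_
  exact hT.tendsto y.1.1.1.2
    ((continuous_subtype_val.comp
      (continuous_fst.comp (continuous_fst.comp continuous_fst))).tendsto y)
    (h5.tendsto y)

end

/-! ### Stationarity of tangent fields -/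

section

variable {d : ℕ} {k : ℤ} {τ : Nodes d k} {V : Type*} [AddCommGroup V] [Module ℂ V]
  [MetricSpace V] {Ω : Type*} [MeasurableSpace Ω]
  {P : Measure Ω} [IsProbabilityMeasure P] {X : Ω → Sc τ V}

/-- The rescaled fields, as random continuous paths converging in law to the path of the tangent
field. -/
theorem IsTangentField.exists_paths [MeasurableSpace C(E d, V)] [BorelSpace C(E d, V)]
    {s : E d} {T : ℝ → V → V} {c : ℝ → ℝ} {Ω' : Type*}
    [MeasurableSpace Ω'] {P' : Measure Ω'} [IsProbabilityMeasure P'] {Y : Ω' → Sc τ V}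
    (h : IsTangentField P X s T c P' Y) :
    ∃ Q : ℝ → Ω → C(E d, V),
      (∀ r, 0 < r → ∀ ω w r', ∀ l : Lam d k, integ (Q r ω) (moveMeas w r' l) =
        T (c r) (X ω (move (s + r • w) (r * r') l))) ∧
      (∀ r, 0 < r → ∀ ω t, Q r ω t = T (c r) (X ω (move s r (τ.lam t)))) ∧
      TendstoInDistribution Q (𝓝[>] 0) (fun ω => (Y ω).rep) (fun _ => P) P' := by
  obtain ⟨Z, hZ, hZt⟩ := h.tendsto
  refine ⟨fun r ω => (Z r ω).rep, fun r hr ω w r' l => ?_, fun r hr ω t => hZ r hr ω _,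
    hZt.continuous_comp Sc.continuous_rep⟩
  rw [← move_move, ← hZ r hr]
  exact ((Z r ω).apply_eq_integ (move w r' l)).symm

theorem tendsto_inv_nat_succ (q : ℝ) (hq : 0 < q) :
    Tendsto (fun n : ℕ => q * ((n + 1 : ℕ) : ℝ)⁻¹) atTop (𝓝[>] 0) := by
  refine tendsto_nhdsWithin_iff.2 ⟨?_, Eventually.of_forall fun n => Set.mem_Ioi.2 (by positivity)⟩
  simpa using (tendsto_one_div_add_atTop_nhds_zero_nat (𝕜 := ℝ)).const_mul q

variable [IsTopologicalAddGroup V] [ContinuousSMul ℂ V]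
  [MeasurableSpace V] [BorelSpace V]

theorem isStrictlyIntrinsicallyStationary_of_identDistrib_pathMove
    [MeasurableSpace C(E d, V)] [BorelSpace C(E d, V)] {Ω' : Type*}
    [MeasurableSpace Ω'] {P' : Measure Ω'} {Y : Ω' → Sc τ V}
    (h : ∀ w, IdentDistrib (fun ω => pathMove τ w 1 (Y ω).rep) (fun ω => (Y ω).rep) P' P') :
    IsStrictlyIntrinsicallyStationary P' Y := by
  intro w m l
  have hm : Measurable fun (g : C(E d, V)) (i : Fin m) => integ g (l i : FinMeas d) :=
    measurable_pi_lambda _ fun i => (continuous_integ _).measurable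
  convert (h w).comp hm using 1
  · funext ω i
    show _ = integ (pathMove τ w 1 (Y ω).rep) (l i : FinMeas d)
    rw [integ_pathMove τ w 1 _ (l i).2]
    exact (Y ω).apply_eq_integ _
  · funext ω i
    exact (Y ω).apply_eq_integ _

variable [TopologicalSpace.SeparableSpace V] {B : Set (E d)} {T : E d → ℝ → V → V} {c : E d → ℝ → ℝ}
  {Ω' : E d → Type*} [∀ s, MeasurableSpace (Ω' s)] {P' : ∀ s, Measure (Ω' s)}
  [∀ s, IsProbabilityMeasure (P' s)] {Y : ∀ s, Ω' s → Sc τ V}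

/-- Under the regularity condition, the tangent fields are strictly intrinsically stationary at
almost every point, namely at every common density point of the near-constancy sets
containing it. -/
theorem ae_isStrictlyIntrinsicallyStationary_of_scalingRegularOn
    (hT : ∀ s ∈ B, IsScalingAction (T s))
    (hY : ∀ s ∈ B, IsTangentField P X s (T s) (c s) (P' s) (Y s)) (hreg : ScalingRegularOn B T c) :
    ∀ᵐ s ∂(volume : Measure (E d)), s ∈ B → IsStrictlyIntrinsicallyStationary (P' s) (Y s) := by
  borelize C(E d, V)
  have hQ' : ∀ s, ∃ Q : ℝ → Ω → C(E d, V), s ∈ B →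
      (∀ r, 0 < r → ∀ ω w r', ∀ l : Lam d k, integ (Q r ω) (moveMeas w r' l) =
        T s (c s r) (X ω (move (s + r • w) (r * r') l))) ∧
      (∀ r, 0 < r → ∀ ω t, Q r ω t = T s (c s r) (X ω (move s r (τ.lam t)))) ∧
      TendstoInDistribution Q (𝓝[>] 0) (fun ω => (Y s ω).rep) (fun _ => P) (P' s) := by
    intro s
    by_cases hs : s ∈ B
    · obtain ⟨Q, hQ⟩ := (hY s hs).exists_paths
      exact ⟨Q, fun _ => hQ⟩
    · exact ⟨fun _ _ => 0, fun h => (hs h).elim⟩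
  choose Q hQ using hQ'
  obtain ⟨h, hh⟩ := exists_isConvergenceDetermining C(E d, V)
  let ρ : ℕ → ℝ := fun n => ((n + 1 : ℕ) : ℝ)⁻¹
  have hρ : ∀ n, 0 < ρ n := fun n => by positivity
  have hρt : Tendsto ρ atTop (𝓝[>] 0) := by simpa [ρ] using tendsto_inv_nat_succ 1 one_pos
  let F : ℕ → ℕ → E d → ℝ := fun i n s => ∫ ω, (h i (Q s (ρ n) ω) : ℝ) ∂P
  have hdens := ae_all_iff.2 fun p => ae_exists_tendsto_of_mem (nearConstSet F B p)
  filter_upwards [hdens] with s hs hsB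
  refine isStrictlyIntrinsicallyStationary_of_identDistrib_pathMove fun w₀ => ?_
  have hX := tendstoInDistribution_comp_subseq (hQ s hsB).2.2 hρt
  have hF : ∀ i, Tendsto (fun n => F i n s) atTop (𝓝 (∫ ω, (h i (Y s ω).rep : ℝ) ∂(P' s))) :=
    fun i => tendsto_integral_of_tendstoInDistribution hX (h i)
  have hm1 : AEMeasurable (fun ω => pathMove τ w₀ 1 (Y s ω).rep) (P' s) :=
    (continuous_pathMove τ w₀ 1).measurable.comp_aemeasurable hX.aemeasurable_limit
  -- For given `i` and `j`, base points `σ n = s + w n / n` taken in one of the near-constancy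
  -- sets give rescaled paths whose laws tend to that of the translated tangent field, while their
  -- `h i`-integrals stay within `2/(j+1)` of that of the tangent field itself.
  have key : ∀ i, ∫ ω, (h i (pathMove τ w₀ 1 (Y s ω).rep) : ℝ) ∂(P' s) =
      ∫ ω, (h i (Y s ω).rep : ℝ) ∂(P' s) := by
    intro i
    have hj : ∀ j : ℕ, |∫ ω, (h i (pathMove τ w₀ 1 (Y s ω).rep) : ℝ) ∂(P' s) -
        ∫ ω, (h i (Y s ω).rep : ℝ) ∂(P' s)| ≤ 2 * ((j : ℝ) + 1)⁻¹ := by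
      intro j
      obtain ⟨N, q, hNq⟩ := exists_mem_nearConstSet hsB (hF i) j
      obtain ⟨w, hw, hwA⟩ := hs (i, j, N, q) hNq w₀
      let σ : ℕ → E d := fun n => s + (n : ℝ)⁻¹ • w n
      have hσB : ∀ n, σ n ∈ B := fun n => (hwA n).1
      -- Indices are shifted by one because nothing is known at `n = 0`, where `n⁻¹ = 0`.
      have hid : TendstoToId fun n x =>
          T (σ (n + 1)) (c (σ (n + 1)) (ρ n)) (T s (c s (ρ n))⁻¹ x) := by
        intro x x₀ hx
        have h1 : Tendsto (fun n => x (n - 1)) atTop (𝓝 x₀) :=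
          hx.comp (tendsto_sub_atTop_nat 1)
        have h2 := hreg s hsB w w₀ hw σ (fun n _ => rfl) (fun n _ => hσB n) _ _ h1
        simpa [ρ] using (tendsto_add_atTop_iff_nat 1).2 h2
      let A : ℕ → C(V, V) := fun n =>
        ⟨fun x => T (σ (n + 1)) (c (σ (n + 1)) (ρ n)) (T s (c s (ρ n))⁻¹ x),
          ((hT _ (hσB _)).continuous_apply ((hY _ (hσB _)).pos _ (hρ n))).comp
            ((hT s hsB).continuous_apply (inv_pos.2 ((hY s hsB).pos _ (hρ n))))⟩
      have hWeq : ∀ n ω, (A n).comp (pathMove τ (w (n + 1)) 1 (Q s (ρ n) ω)) =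
          Q (σ (n + 1)) (ρ n) ω := by
        intro n ω
        ext t
        have h1 : pathMove τ (w (n + 1)) 1 (Q s (ρ n) ω) t =
            T s (c s (ρ n)) (X ω (move (σ (n + 1)) (ρ n) (τ.lam t))) := by
          have h2 := (hQ s hsB).1 (ρ n) (hρ n) ω (w (n + 1)) 1 (τ.lam t)
          rwa [mul_one] at h2
        show T (σ (n + 1)) (c (σ (n + 1)) (ρ n)) (T s (c s (ρ n))⁻¹
          (pathMove τ (w (n + 1)) 1 (Q s (ρ n) ω) t)) = _
        rw [h1, (hT s hsB).inv_apply_apply ((hY s hsB).pos _ (hρ n)),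
          (hQ _ (hσB _)).2.1 _ (hρ n)]
      have hconv := fun g => tendsto_comp_pathMove (τ := τ) (A := A)
        (fun x => hid.tendsto_prod x) ((tendsto_add_atTop_iff_nat 1).2 hw) g
      have hWm : ∀ n, AEMeasurable
          (fun ω => (A n).comp (pathMove τ (w (n + 1)) 1 (Q s (ρ n) ω))) P := fun n => by
        simp only [hWeq]
        exact (hQ _ (hσB _)).2.2.forall_aemeasurable _
      have hW := tendstoInDistribution_extended_comp hX
        (g := fun n g => (A n).comp (pathMove τ (w (n + 1)) 1 g)) (g₀ := pathMove τ w₀ 1)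
        hconv hWm hm1
      simp only [hWeq] at hW
      have h3 := tendsto_integral_of_tendstoInDistribution hW (h i)
      refine le_of_tendsto (h3.sub_const _).abs (eventually_atTop.2 ⟨N, fun n hn => ?_⟩)
      show |F i n (σ (n + 1)) - _| ≤ _
      exact abs_sub_le_of_mem_nearConstSet hNq (hwA (n + 1)) (hF i) hn
    have hlim : Tendsto (fun j : ℕ => 2 * ((j : ℝ) + 1)⁻¹) atTop (𝓝 0) := by
      simpa using (tendsto_one_div_add_atTop_nhds_zero_nat (𝕜 := ℝ)).const_mul 2
    exact sub_eq_zero.1 (abs_eq_zero.1 (le_antisymm (ge_of_tendsto' hlim hj) (abs_nonneg _)))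
  exact hh.identDistrib hm1 hX.aemeasurable_limit key

/-- For a single scaling action, the regularity condition holds on compact sets that exhaust `B`
up to a null set. On such a set the rescaled laws converge locally uniformly, so the paths seen
from `s` and from `s + wₙ/n` have the same limit in law; these differ by a translation and a
scaling, which has to be asymptotically trivial. -/
theorem exists_isCompact_scalingRegularOn (hX : Measurable X) (hB : MeasurableSet B)
    (hT : ∀ s ∈ B, IsScalingAction (T s)) (hc : ∀ r, 0 < r → Measurable fun s : B => c s r)
    (hY : ∀ s ∈ B, IsTangentField P X s (T s) (c s) (P' s) (Y s))
    (hTT : ∀ s ∈ B, ∀ s' ∈ B, ∀ a, 0 < a → T s a = T s' a) :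
    ∃ K : ℕ → Set (E d), (∀ m, IsCompact (K m) ∧ K m ⊆ B ∧ ScalingRegularOn (K m) T c) ∧
      (volume : Measure (E d)) (B \ ⋃ m, K m) = 0 := by
  borelize C(E d, V)
  obtain rfl | ⟨s₀, hs₀⟩ := B.eq_empty_or_nonempty
  · exact ⟨fun _ => ∅, fun _ => ⟨isCompact_empty, le_rfl, fun s hs => hs.elim⟩, by simp⟩
  have hT₀ := hT s₀ hs₀
  have hQ' : ∀ s, ∃ Q : ℝ → Ω → C(E d, V), s ∈ B →
      (∀ r, 0 < r → ∀ ω w r', ∀ l : Lam d k, integ (Q r ω) (moveMeas w r' l) =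
        T s₀ (c s r) (X ω (move (s + r • w) (r * r') l))) ∧
      (∀ r, 0 < r → ∀ ω t, Q r ω t = T s₀ (c s r) (X ω (move s r (τ.lam t)))) ∧
      TendstoInDistribution Q (𝓝[>] 0) (fun ω => (Y s ω).rep) (fun _ => P) (P' s) := by
    intro s
    by_cases hs : s ∈ B
    · obtain ⟨Q, hQ1, hQ2, hQ3⟩ := (hY s hs).exists_paths
      refine ⟨Q, fun _ => ⟨fun r hr ω w r' l => ?_, fun r hr ω t => ?_, hQ3⟩⟩
      · rw [hQ1 r hr, hTT s hs s₀ hs₀ _ ((hY s hs).pos r hr)]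
      · rw [hQ2 r hr, hTT s hs s₀ hs₀ _ ((hY s hs).pos r hr)]
    · exact ⟨fun _ _ => 0, fun h => (hs h).elim⟩
  choose Q hQ using hQ'
  obtain ⟨h, hh⟩ := exists_isConvergenceDetermining C(E d, V)
  let ρ : ℕ → ℝ := fun n => ((n + 1 : ℕ) : ℝ)⁻¹
  have hρ : ∀ n, 0 < ρ n := fun n => by positivity
  have hρt : Tendsto ρ atTop (𝓝[>] 0) := by simpa [ρ] using tendsto_inv_nat_succ 1 one_pos
  let F : ℕ → ℕ → E d → ℝ := fun i n s => ∫ ω, (h i (Q s (ρ n) ω) : ℝ) ∂P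
  have hFm : ∀ i n, Measurable fun s : B => F i n s := by
    intro i n
    obtain ⟨Φ, hΦ, hΦa⟩ := continuous_scaled_pathMove τ hT₀ (ρ n)
    have hpos : ∀ s : B, c s (ρ n) ∈ Set.Ioi (0 : ℝ) := fun s => (hY s s.2).pos _ (hρ n)
    have hQΦ : ∀ (s : B) ω, Q s (ρ n) ω = Φ ((⟨c s (ρ n), hpos s⟩, s), (X ω).rep) := by
      intro s ω
      ext t
      rw [hΦa, (hQ s s.2).2.1 _ (hρ n), Sc.pathMove_rep_apply]
    have hm : Measurable fun p : B × Ω => ((h i (Q p.1 (ρ n) p.2) : ℝ≥0) : ℝ) := by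
      simp only [hQΦ]
      refine (NNReal.continuous_coe.comp (h i).continuous).measurable.comp (hΦ.measurable.comp ?_)
      refine Measurable.prodMk (Measurable.prodMk ?_ ?_) ?_
      · exact (((hc _ (hρ n)).subtype_mk).comp measurable_fst)
      · exact measurable_subtype_coe.comp measurable_fst
      · exact Sc.continuous_rep.measurable.comp (hX.comp measurable_snd)
    exact (hm.stronglyMeasurable.integral_prod_right).measurable
  obtain ⟨K, hK, hK0⟩ := exists_isCompact_seq_forall_inter_open
    (volume : Measure (E d)).toFinite hB (nearConstSet F B)
    (measurableSet_nearConstSet hB hFm)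
  refine ⟨K, fun m => ⟨(hK m).1, (hK m).2.1, ?_⟩, absolutelyContinuous_toFinite _ hK0⟩
  intro s hsK w w₀ hw σ hσ hσK x x₀ hx
  have hsB := (hK m).2.1 hsK
  have hσB : ∀ n, σ (n + 1) ∈ B := fun n => (hK m).2.1 (hσK _ (by omega))
  have hσn : ∀ n, σ (n + 1) = s + ρ n • w (n + 1) := fun n => hσ _ (by omega)
  have hw1 : Tendsto (fun n => w (n + 1)) atTop (𝓝 w₀) := (tendsto_add_atTop_iff_nat 1).2 hw
  have hσt : Tendsto (fun n => σ (n + 1)) atTop (𝓝 s) := by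
    simp only [hσn]
    have h1 : Tendsto ρ atTop (𝓝 0) := tendsto_nhds_of_tendsto_nhdsWithin hρt
    simpa using (h1.smul hw1).const_add s
  have hXt := tendstoInDistribution_comp_subseq (hQ s hsB).2.2 hρt
  have hF : ∀ i, Tendsto (fun n => F i n s) atTop (𝓝 (∫ ω, (h i (Y s ω).rep : ℝ) ∂(P' s))) :=
    fun i => tendsto_integral_of_tendstoInDistribution hXt (h i)
  have hWm : ∀ n, AEMeasurable (fun ω => Q (σ (n + 1)) (ρ n) ω) P :=
    fun n => (hQ _ (hσB n)).2.2.forall_aemeasurable _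
  -- Moving the base points inside `K m` does not change the limit law.
  have hW : TendstoInDistribution (fun n ω => Q (σ (n + 1)) (ρ n) ω) atTop
      (fun ω => (Y s ω).rep) (fun _ => P) (P' s) := by
    refine hh.tendstoInDistribution hWm hXt.aemeasurable_limit fun i => ?_
    refine Metric.tendsto_atTop.2 fun ε hε => ?_
    obtain ⟨j, hj⟩ := exists_nat_one_div_lt (half_pos hε)
    obtain ⟨N, q, hNq⟩ := exists_mem_nearConstSet hsB (hF i) j
    obtain ⟨O, hO, hKO⟩ := (hK m).2.2 (i, j, N, q)
    have hsO : s ∈ O := (hKO.subset ⟨hsK, hNq⟩).2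
    obtain ⟨N', hN'⟩ := eventually_atTop.1 (hσt.eventually (hO.mem_nhds hsO))
    refine ⟨max N N', fun n hn => ?_⟩
    have h1 : σ (n + 1) ∈ nearConstSet F B (i, j, N, q) :=
      (hKO.symm.subset ⟨hσK _ (by omega), hN' n (le_of_max_le_right hn)⟩).2
    have h2 := abs_sub_le_of_mem_nearConstSet hNq h1 (hF i) (le_of_max_le_left hn)
    rw [Real.dist_eq]
    rw [one_div] at hj
    refine lt_of_le_of_lt ?_ (by linarith : 2 * ((j : ℝ) + 1)⁻¹ < ε)
    exact h2
  have hcpos : ∀ t ∈ B, ∀ r, 0 < r → 0 < c t r := fun t ht => (hY t ht).pos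
  let a : ℕ → ℝ := fun n => c (σ (n + 1)) (ρ n) * (c s (ρ n))⁻¹
  let b : ℕ → ℝ := fun n => c s (2 * ρ n) * (c s (ρ n))⁻¹
  have ha : ∀ n, 0 < a n := fun n =>
    mul_pos (hcpos _ (hσB n) _ (hρ n)) (inv_pos.2 (hcpos s hsB _ (hρ n)))
  have hb : ∀ n, 0 < b n := fun n =>
    mul_pos (hcpos s hsB _ (mul_pos two_pos (hρ n))) (inv_pos.2 (hcpos s hsB _ (hρ n)))
  have hZ : ∀ (w : E d) (r : ℝ), 0 < r →
      ∃ l : Lam d k, ¬ ∀ᵐ ω ∂(P' s), integ (Y s ω).rep (moveMeas w r l) = 0 := by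
    intro w r hr
    obtain ⟨l, hl⟩ := Sc.exists_not_ae_eq_zero (hY s hsB).nonzero w hr.ne'
    refine ⟨l, fun h0 => hl (h0.mono fun ω hω => ?_)⟩
    rw [Sc.apply_eq_integ]
    exact hω
  have hb2 : ∀ l : Lam d k, TendstoInDistribution
      (fun n ω => T s₀ (b n) (integ (Q s (ρ n) ω) (moveMeas 0 2 l))) atTop
      (fun ω => integ (Y s ω).rep (l : FinMeas d)) (fun _ => P) (P' s) := by
    intro l
    have h1 := (tendstoInDistribution_comp_subseq (hQ s hsB).2.2
      (tendsto_inv_nat_succ 2 two_pos)).continuous_comp (continuous_integ (V := V) (l : FinMeas d))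
    convert h1 using 1
    · funext n ω
      have h2 := (hQ s hsB).1 (2 * ρ n) (mul_pos two_pos (hρ n)) ω 0 1 l
      rw [moveMeas_zero_one] at h2
      show _ = integ (Q s (2 * ρ n) ω) (l : FinMeas d)
      rw [h2, (hQ s hsB).1 (ρ n) (hρ n), ← hT₀.comp _ _ (hcpos s hsB _ (mul_pos two_pos (hρ n)))
        (inv_pos.2 (hcpos s hsB _ (hρ n))), hT₀.inv_apply_apply (hcpos s hsB _ (hρ n)),
        smul_zero, smul_zero, mul_one, mul_comm (ρ n)]
    · rfl
  have hW1 : ∀ l : Lam d k, TendstoInDistribution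
      (fun n ω => T s₀ (a n) (integ (Q s (ρ n) ω) (moveMeas (w (n + 1)) 1 l))) atTop
      (fun ω => integ (Y s ω).rep (l : FinMeas d)) (fun _ => P) (P' s) := by
    intro l
    have h1 := hW.continuous_comp (continuous_integ (V := V) (l : FinMeas d))
    convert h1 using 1
    · funext n ω
      have h2 := (hQ _ (hσB n)).1 (ρ n) (hρ n) ω 0 1 l
      rw [moveMeas_zero_one] at h2
      show _ = integ (Q (σ (n + 1)) (ρ n) ω) (l : FinMeas d)
      rw [h2, (hQ s hsB).1 (ρ n) (hρ n), ← hT₀.comp _ _ (hcpos _ (hσB n) _ (hρ n))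
        (inv_pos.2 (hcpos s hsB _ (hρ n))), hT₀.inv_apply_apply (hcpos s hsB _ (hρ n)),
        smul_zero, add_zero, ← hσn]
    · rfl
  have hone := tendsto_scaling_one hT₀ hXt hZ hb hb2 hw1 ha hW1
  refine (tendsto_add_atTop_iff_nat 1).1 ?_
  have h1 := hT₀.tendsto one_pos hone ((tendsto_add_atTop_iff_nat 1).2 hx)
  rw [hT₀.one] at h1
  refine h1.congr fun n => ?_
  show _ = T (σ (n + 1)) (c (σ (n + 1)) (ρ n)) (T s (c s (ρ n))⁻¹ (x (n + 1)))
  rw [hTT _ (hσB n) s₀ hs₀ _ (hcpos _ (hσB n) _ (hρ n)),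
    hTT s hsB s₀ hs₀ _ (inv_pos.2 (hcpos s hsB _ (hρ n))),
    hT₀.comp _ _ (hcpos _ (hσB n) _ (hρ n)) (inv_pos.2 (hcpos s hsB _ (hρ n)))]

end

end TangentField

theorem theorem3p2
    {d : ℕ} {k : ℤ} (hk : -1 ≤ k) (τ : Nodes d k)
    {V : Type*} [AddCommGroup V] [Module ℂ V] [MetricSpace V] [CompleteSpace V]
    [TopologicalSpace.SeparableSpace V] [IsTopologicalAddGroup V] [ContinuousSMul ℂ V]
    [MeasurableSpace V] [BorelSpace V]
    (hdist : ∀ x y : V, dist x y = dist (x - y) 0)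
    {Ω : Type*} [MeasurableSpace Ω] (P : Measure Ω) [IsProbabilityMeasure P]
    (X : Ω → Sc τ V) (hX : Measurable X)
    (B : Set (E d)) (hB : MeasurableSet B)
    (T : E d → ℝ → V → V) (hT : ∀ s ∈ B, IsScalingAction (T s))
    (c : E d → ℝ → ℝ) (hc : ∀ r, 0 < r → Measurable fun s : B => c s r)
    {Ω' : E d → Type*} [∀ s, MeasurableSpace (Ω' s)] (P' : ∀ s, Measure (Ω' s))
    [∀ s, IsProbabilityMeasure (P' s)] (Y : ∀ s, Ω' s → Sc τ V)
    (hY : ∀ s ∈ B, IsTangentField P X s (T s) (c s) (P' s) (Y s)) :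
    -- a general family of scaling actions satisfying the regularity condition
    (ScalingRegularOn B T c →
      ∀ᵐ s ∂(volume : Measure (E d)), s ∈ B → IsStrictlyIntrinsicallyStationary (P' s) (Y s)) ∧
    -- a scaling action that does not depend on the location: no regularity condition is
    -- assumed, and it holds on compact sets exhausting `B` up to a null set
    ((∀ s ∈ B, ∀ s' ∈ B, ∀ a, 0 < a → T s a = T s' a) →
      (∃ K : ℕ → Set (E d), (∀ m, IsCompact (K m) ∧ K m ⊆ B ∧ ScalingRegularOn (K m) T c) ∧
        (volume : Measure (E d)) (B \ ⋃ m, K m) = 0) ∧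
      ∀ᵐ s ∂(volume : Measure (E d)), s ∈ B → IsStrictlyIntrinsicallyStationary (P' s) (Y s)) := by
  refine ⟨fun hreg => ae_isStrictlyIntrinsicallyStationary_of_scalingRegularOn hT hY hreg,
    fun hTT => ?_⟩
  obtain ⟨K, hK, hK0⟩ := exists_isCompact_scalingRegularOn hX hB hT hc hY hTT
  refine ⟨⟨K, hK, hK0⟩, ?_⟩
  have h1 : ∀ᵐ s ∂(volume : Measure (E d)), ∀ m, s ∈ K m →
      IsStrictlyIntrinsicallyStationary (P' s) (Y s) := ae_all_iff.2 fun m =>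
    ae_isStrictlyIntrinsicallyStationary_of_scalingRegularOn
      (fun s hs => hT s ((hK m).2.1 hs)) (fun s hs => hY s ((hK m).2.1 hs)) (hK m).2.2
  filter_upwards [h1, measure_eq_zero_iff_ae_notMem.1 hK0] with s hs hs0 hsB
  by_contra hcon
  refine hs0 ⟨hsB, fun hmem => ?_⟩
  obtain ⟨m, hm⟩ := Set.mem_iUnion.1 hmem
  exact hcon (hs m hm)
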